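/- **Theorem.** Let $X$ be a tree that is regular of valency $q+1$ ($q\in\mathbb N$), and let $G=\mathrm{Aut}(X)$ with the topology in which the pointwise stabilizers of finite nonempty sets of vertices form a basis of neighbourhoods of the unit. Fix a line $l=(\dots,v_{-1},v_0,v_1,\dots)$ in $X$ (a two-sided infinite path without backtracking) and let $\infty$ be the boundary point given by the ray $(v_0,v_1,\dots)$. Let $P\subset G$ be the stabilizer of $\infty$, and let $S\subset P$ be the subgroup of elements preserving every horosphere with respect to $\infty$. (Two vertices $x,y$ lie in the same horosphere if the rays $(v_n(x))_{n\ge0}$ and $(v_n(y))_{n\ge 0}$ from $x$ and $y$ to $\infty$ satisfy $v_n(x)=v_n(y)$ for some $n$.) Let $L\subset P$ be the subgroup preserving $l$ and let $M=L\cap S$; then $L/M$ is infinite cyclic. Let $A\subset L$ be the image of a splitting of $1\to M\to L\to L/M\to 1$. Let $A^-$ be the set of all $a\in A$ such that, for some integer $k>0$, $av_i=v_{i-k}$ for all $i\in\mathbb Z$, and let $a_1$ be the generator of $A$ that lies in $A^-$. For $j\ge 0$ let $K_j$ be the compact open subgroup of all $g\in G$ fixing every vertex $v$ with $d(v_0,v)\le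 j$. Fix a Haar measure on $G$. Let $\pi$ be an admissible representation of $G$ on a complex vector space, i.e. every vector is fixed by some compact open subgroup, and for every compact open subgroup $K$ the space $\pi^K$ of $K$-fixed vectors is finite dimensional. Let $\pi_S=\pi/\pi[S]$, where $\pi[S]$ is the span of all $v-\pi(s)v$ with $v\in\pi$, $s\in S$; the group $P$ acts on $\pi_S$. For a compact open set $Y\subset G$ put $\pi(\mathbf 1_Y)=\int_Y\pi(x)\,dx$. Then for all $j,m\ge 1$ the operator $\pi(\mathbf 1_{K_ja_1^mK_j})$ has finite rank, the space $\pi_S$ is finite dimensional, and $$ \mathrm{tr}\left(\frac{1}{\mathrm{vol}(K_ja_1^mK_j)}\,\pi\big(\mathbf 1_{K_ja_1^mK_j}\big)\right)=\mathrm{tr}\,\pi_S(a_1^m). $$ -/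

import Mathlib

open scoped Pointwise

namespace TreeHecke

/-! ### Rays, cusps, horospheres and subgroups of the automorphism group -/

section Combinatorics

variable {V : Type*} {X : SimpleGraph V}

/-- A ray: a one-sided infinite path without backtracking. -/
@[ext]
structure Ray (X : SimpleGraph V) where
  vertex : ℕ → V
  adj : ∀ j, X.Adj (vertex j) (vertex (j + 1))
  no_backtrack : ∀ j, vertex j ≠ vertex (j + 2)

/-- A line: a two-sided infinite path without backtracking. -/
@[ext]
structure Line (X : SimpleGraph V) where
  vertex : ℤ → V
  adj : ∀ j, X.Adj (vertex j) (vertex (j + 1))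
  no_backtrack : ∀ j, vertex j ≠ vertex (j + 2)

/-- Two rays are parallel if `v_j = w_{j+s}` for some `s ∈ ℤ` and all large `j`. -/
def Ray.Parallel (r r' : Ray X) : Prop :=
  ∃ s : ℤ, ∃ N : ℕ, ∀ j : ℕ, N ≤ j → ∃ k : ℕ, (k : ℤ) = j + s ∧ r.vertex j = r'.vertex k

instance raySetoid (X : SimpleGraph V) : Setoid (Ray X) where
  r := Ray.Parallel
  iseqv := by
    refine ⟨fun r => ⟨0, 0, fun j _ => ⟨j, by simp, rfl⟩⟩, ?_, ?_⟩
    · rintro r r' ⟨s, N, h⟩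
      refine ⟨-s, (N + s).toNat + s.toNat, fun j hj => ?_⟩
      obtain ⟨i, hi⟩ : ∃ i : ℕ, (i : ℤ) = j + -s := ⟨(j + -s).toNat, by omega⟩
      obtain ⟨k, hk, hk'⟩ := h i (by omega)
      obtain rfl : k = j := by omega
      exact ⟨i, hi, hk'.symm⟩
    · rintro r r' r'' ⟨s, N, h⟩ ⟨s', N', h'⟩
      refine ⟨s + s', N + (N' - s).toNat, fun j hj => ?_⟩
      obtain ⟨k, hk, hk'⟩ := h j (by omega)
      obtain ⟨i, hi, hi'⟩ := h' k (by omega)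
      exact ⟨i, by omega, hk'.trans hi'⟩

/-- The boundary `∂X`: the set of parallelity classes of rays, called cusps. -/
def Boundary (X : SimpleGraph V) : Type _ := Quotient (raySetoid X)

/-- The cusp given by a ray. -/
def Ray.cusp (r : Ray X) : Boundary X := Quotient.mk (raySetoid X) r

/-- Automorphisms act on rays vertex by vertex. -/
instance : MulAction (X ≃g X) (Ray X) where
  smul g r :=
    { vertex := fun j => g • r.vertex j
      adj := fun j => g.map_rel_iff.2 (r.adj j)
      no_backtrack := fun j h => r.no_backtrack j (g.injective h) }
  one_smul _ := rfl
  mul_smul _ _ _ := rfl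

theorem Ray.smul_vertex (g : X ≃g X) (r : Ray X) (j : ℕ) :
    (g • r).vertex j = g • r.vertex j := rfl

/-- The action of the automorphism group on the boundary. -/
instance : MulAction (X ≃g X) (Boundary X) where
  smul g := Quotient.map (g • ·) (by
    rintro r r' ⟨s, N, h⟩
    refine ⟨s, N, fun j hj => ?_⟩
    obtain ⟨k, hk, hk'⟩ := h j hj
    exact ⟨k, hk, congrArg (g • ·) hk'⟩)
  one_smul b := by
    induction b using Quotient.inductionOn
    rfl
  mul_smul g h b := by
    induction b using Quotient.inductionOn
    rfl

theorem Ray.cusp_smul (g : X ≃g X) (r : Ray X) : (g • r).cusp = g • r.cusp := rfl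

/-- The vertices `x`, `y` lie in the same horosphere with respect to the cusp `b`: the rays in the
class `b` that start at `x` and at `y` satisfy `v_N(x) = v_N(y)` for some `N`. -/
def SameHorosphere (b : Boundary X) (x y : V) : Prop :=
  ∃ r r' : Ray X, r.vertex 0 = x ∧ r.cusp = b ∧ r'.vertex 0 = y ∧ r'.cusp = b ∧
    ∃ N : ℕ, r.vertex N = r'.vertex N

/-- The horospheres with respect to the cusp `b`. -/
def IsHorosphere (b : Boundary X) (H : Set V) : Prop :=
  ∃ x : V, H = {y | SameHorosphere b x y}

/-- The parabolic subgroup `P`: the stabilizer of the cusp `b`. -/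
def parabolic (b : Boundary X) : Subgroup (X ≃g X) := MulAction.stabilizer (X ≃g X) b

/-- The subgroup `S` of those elements of `P` that preserve horospheres. -/
def horosphericalSubgroup (b : Boundary X) : Subgroup (X ≃g X) where
  carrier := {g | g ∈ parabolic b ∧ ∀ H : Set V, IsHorosphere b H → g • H = H}
  one_mem' := ⟨one_mem _, fun H _ => one_smul _ H⟩
  mul_mem' := fun {g h} hg hh =>
    ⟨mul_mem hg.1 hh.1, fun H hH => by rw [mul_smul, hh.2 H hH, hg.2 H hH]⟩
  inv_mem' := fun {g} hg =>
    ⟨inv_mem hg.1, fun H hH => by rw [inv_smul_eq_iff, hg.2 H hH]⟩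

theorem SameHorosphere.smul {b : Boundary X} {x y : V} (h : SameHorosphere b x y) {p : X ≃g X}
    (hp : p ∈ parabolic b) : SameHorosphere b (p • x) (p • y) := by
  obtain ⟨r, r', rfl, hr, rfl, hr', N, hN⟩ := h
  have hp' : p • b = b := hp
  refine ⟨p • r, p • r', rfl, ?_, rfl, ?_, N, congrArg (p • ·) hN⟩
  · rw [Ray.cusp_smul, hr, hp']
  · rw [Ray.cusp_smul, hr', hp']

theorem IsHorosphere.smul {b : Boundary X} {H : Set V} (h : IsHorosphere b H) {p : X ≃g X}
    (hp : p ∈ parabolic b) : IsHorosphere b (p • H) := by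
  obtain ⟨x, rfl⟩ := h
  refine ⟨p • x, Set.ext fun y => ?_⟩
  rw [Set.mem_smul_set_iff_inv_smul_mem]
  constructor
  · intro hy
    have := SameHorosphere.smul hy hp
    rwa [smul_inv_smul] at this
  · intro hy
    have := SameHorosphere.smul hy (inv_mem hp)
    rwa [inv_smul_smul] at this

/-- `S` is normal in `P`. -/
instance horosphericalSubgroup_normal (b : Boundary X) :
    ((horosphericalSubgroup b).subgroupOf (parabolic b)).Normal where
  conj_mem := by
    rintro ⟨s, hsP⟩ hs ⟨p, hp⟩
    refine ⟨mul_mem (mul_mem hp hsP) (inv_mem hp), fun H hH => ?_⟩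
    change (p * s * p⁻¹) • H = H
    rw [mul_smul, mul_smul, (Subgroup.mem_subgroupOf.1 hs).2 _ (hH.smul (inv_mem hp)),
      smul_inv_smul]

/-- The ray `(v_0, v_1, v_2, …)` of a line. -/
def Line.posRay (l : Line X) : Ray X where
  vertex j := l.vertex j
  adj j := by simpa using l.adj j
  no_backtrack j := by simpa using l.no_backtrack j

/-- The cusp `∞` given by the ray `(v_0, v_1, v_2, …)`. -/
def Line.infty (l : Line X) : Boundary X := l.posRay.cusp

/-- The Levi component `L` of `P`: the subgroup of `P` that preserves the line `l`. -/
def levi (l : Line X) : Subgroup (X ≃g X) :=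
  parabolic l.infty ⊓ MulAction.stabilizer (X ≃g X) (Set.range l.vertex)

/-- `M = L ∩ S`. -/
def leviM (l : Line X) : Subgroup (X ≃g X) := levi l ⊓ horosphericalSubgroup l.infty

/-- `A` is the image of a splitting `s : C → L` of an exact sequence `1 → M → L → C → 1` with `C`
infinite cyclic. -/
def IsSplitTorus (l : Line X) (A : Subgroup (X ≃g X)) : Prop :=
  ∃ (p : levi l →* Multiplicative ℤ) (s : Multiplicative ℤ →* levi l),
    Function.Surjective p ∧ p.ker = (leviM l).subgroupOf (levi l) ∧
      p.comp s = MonoidHom.id (Multiplicative ℤ) ∧ A = s.range.map (levi l).subtype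

/-- The set `A⁻` of those `a ∈ A` that move the line by a positive distance away from `∞`. -/
def negativePart (l : Line X) (A : Subgroup (X ≃g X)) : Set (X ≃g X) :=
  {a | a ∈ A ∧ ∃ k : ℕ, 0 < k ∧ ∀ j : ℤ, a • l.vertex j = l.vertex (j - k)}

theorem mem_parabolic_of_mem_negativePart {l : Line X} {A : Subgroup (X ≃g X)} {a : X ≃g X}
    (ha : a ∈ negativePart l A) : a ∈ parabolic l.infty := by
  obtain ⟨-, k, -, hk⟩ := ha
  refine Quotient.sound (s := raySetoid X) ⟨-k, k, fun j hj => ⟨j - k, by omega, ?_⟩⟩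
  rw [Ray.smul_vertex]
  simp only [Line.posRay]
  rw [hk, Nat.cast_sub hj]

/-- The group `K_j` of all `g` with `g v = v` for every vertex `v` with `d(v_0, v) ≤ j`. -/
def congruenceSubgroup (l : Line X) (j : ℕ) : Subgroup (X ≃g X) :=
  fixingSubgroup (X ≃g X) {v | X.dist (l.vertex 0) v ≤ j}

end Combinatorics

/-! ### The topology of the automorphism group -/

section Topology

variable {V : Type*} {X : SimpleGraph V}

/-- The topology of pointwise convergence on vertices: the cosets `g K_E` of the pointwise
stabilizers of finite sets `E` of vertices form a basis. -/
instance autTopology : TopologicalSpace (X ≃g X) :=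
  TopologicalSpace.induced (fun g : X ≃g X => (g : V → V)) (@Pi.topologicalSpace V _ fun _ => ⊥)

instance autMeasurableSpace : MeasurableSpace (X ≃g X) := borel _

instance autBorelSpace : BorelSpace (X ≃g X) := ⟨rfl⟩

theorem isOpen_setOf_smul_eq (v w : V) : IsOpen {g : X ≃g X | g • v = w} := by
  let _ : TopologicalSpace V := ⊥
  have : DiscreteTopology V := ⟨rfl⟩
  have h : Continuous fun g : X ≃g X => g v := (continuous_apply v).comp continuous_induced_dom
  exact (isOpen_discrete {w}).preimage h

theorem continuous_aut {Y : Type*} [TopologicalSpace Y] {f : Y → (X ≃g X)}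
    (h : ∀ v w : V, IsOpen {y | f y • v = w}) : Continuous f := by
  let _ : TopologicalSpace V := ⊥
  have : DiscreteTopology V := ⟨rfl⟩
  refine continuous_induced_rng.2 (continuous_pi fun v => ?_)
  exact continuous_discrete_rng.2 fun w => h v w

instance autIsTopologicalGroup : IsTopologicalGroup (X ≃g X) where
  continuous_mul := continuous_aut fun v w => by
    have : {y : (X ≃g X) × (X ≃g X) | (y.1 * y.2) • v = w} =
        ⋃ u : V, {g : X ≃g X | g • u = w} ×ˢ {g : X ≃g X | g • v = u} := by
      ext y
      simp [mul_smul]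
    rw [this]
    exact isOpen_iUnion fun u => (isOpen_setOf_smul_eq u w).prod (isOpen_setOf_smul_eq v u)
  continuous_inv := continuous_aut fun v w => by
    have : {y : X ≃g X | y⁻¹ • v = w} = {g : X ≃g X | g • w = v} := by
      ext y
      simp only [Set.mem_ofPred_eq, inv_smul_eq_iff]
      exact eq_comm
    rw [this]
    exact isOpen_setOf_smul_eq w v

theorem finite_setOf_dist_le [X.LocallyFinite] (hX : X.Connected) (x : V) (n : ℕ) :
    {v | X.dist x v ≤ n}.Finite := by
  induction n with
  | zero =>
    refine (Set.finite_singleton x).subset fun v hv => ?_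
    exact ((hX.dist_eq_zero_iff).1 (Nat.le_zero.1 hv)).symm
  | succ n ih =>
    refine (ih.union (ih.biUnion fun u _ => (X.neighborSet u).toFinite)).subset fun v hv => ?_
    rcases Nat.lt_or_ge n (X.dist x v) with h | h
    · right
      obtain ⟨p, hp⟩ := hX.exists_walk_length_eq_dist v x
      rw [X.dist_comm] at hp
      cases p with
      | nil =>
        have h0 : X.dist x x = 0 := X.dist_self
        omega
      | cons hadj q =>
        rename_i u
        have hq : X.dist x u ≤ q.length := by
          rw [X.dist_comm]
          exact X.dist_le q
        rw [SimpleGraph.Walk.length_cons] at hp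
        have hv' : X.dist x v ≤ n + 1 := hv
        exact Set.mem_biUnion (show u ∈ {v | X.dist x v ≤ n} from by
          change X.dist x u ≤ n
          omega) hadj.symm
    · exact Or.inl h

theorem dist_smul_smul (g : X ≃g X) (hX : X.Connected) (x y : V) :
    X.dist (g • x) (g • y) = X.dist x y := by
  have key : ∀ (g : X ≃g X) (x y : V), X.dist (g • x) (g • y) ≤ X.dist x y := by
    intro g x y
    obtain ⟨p, hp⟩ := hX.exists_walk_length_eq_dist x y
    rw [← hp, ← SimpleGraph.Walk.length_map g.toHom p]
    exact X.dist_le _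
  refine le_antisymm (key g x y) ?_
  simpa using key g⁻¹ (g • x) (g • y)

theorem isOpen_congruenceSubgroup [X.LocallyFinite] (hX : X.Connected) (l : Line X) (j : ℕ) :
    IsOpen (congruenceSubgroup l j : Set (X ≃g X)) := by
  have : (congruenceSubgroup l j : Set (X ≃g X)) =
      ⋂ v ∈ {v | X.dist (l.vertex 0) v ≤ j}, {g : X ≃g X | g • v = v} := by
    ext g
    simp [congruenceSubgroup, mem_fixingSubgroup_iff]
  rw [this]
  exact (finite_setOf_dist_le hX _ j).isOpen_biInter fun v _ => isOpen_setOf_smul_eq v v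

theorem isCompact_congruenceSubgroup [X.LocallyFinite] (hX : X.Connected) (l : Line X) (j : ℕ) :
    IsCompact (congruenceSubgroup l j : Set (X ≃g X)) := by
  let _ : TopologicalSpace V := ⊥
  have : DiscreteTopology V := ⟨rfl⟩
  set v₀ := l.vertex 0 with hv₀
  have hind : Topology.IsInducing (fun g : X ≃g X => (g : V → V)) := ⟨rfl⟩
  rw [hind.isCompact_iff]
  have hclopen : ∀ x y : V, IsClopen {φ : V → V | φ x = y} := fun x y =>
    (isClopen_discrete {y}).preimage (continuous_apply x)
  have himg : (fun g : X ≃g X => (g : V → V)) '' (congruenceSubgroup l j : Set (X ≃g X)) =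
      (⋂ v ∈ {v | X.dist v₀ v ≤ j}, {φ : V → V | φ v = v}) ∩
      (⋂ x : V, ⋂ y : V, {φ : V → V | X.Adj (φ x) (φ y) ↔ X.Adj x y}) ∩
      (⋂ x : V, ⋂ y : V, {φ : V → V | φ x = φ y → x = y}) ∩
      (⋂ y : V, ⋃ x ∈ {x | X.dist v₀ x ≤ X.dist v₀ y}, {φ : V → V | φ x = y}) ∩
      Set.univ.pi (fun x => {y | X.dist v₀ y ≤ X.dist v₀ x}) := by
    ext φ
    simp only [Set.mem_image, SetLike.mem_coe, Set.mem_inter_iff, Set.mem_iInter,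
      Set.mem_ofPred_eq, Set.mem_iUnion, Set.mem_pi, Set.mem_univ, true_imp_iff]
    constructor
    · rintro ⟨g, hg, rfl⟩
      have hg' : ∀ v, X.dist v₀ v ≤ j → g • v = v := (mem_fixingSubgroup_iff _).1 hg
      have h0 : g • v₀ = v₀ := hg' v₀ (by simp)
      have h0' : g⁻¹ • v₀ = v₀ := by rw [inv_smul_eq_iff, h0]
      refine ⟨⟨⟨⟨hg', fun x y => g.map_rel_iff⟩, fun x y h => g.injective h⟩, fun y => ?_⟩,
        fun x => ?_⟩
      · refine ⟨g⁻¹ • y, ?_, smul_inv_smul g y⟩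
        have := dist_smul_smul g⁻¹ hX v₀ y
        rw [h0'] at this
        exact this.le
      · have := dist_smul_smul g hX v₀ x
        rw [h0] at this
        exact this.le
    · rintro ⟨⟨⟨⟨h1, h2⟩, h3⟩, h4⟩, -⟩
      refine ⟨⟨Equiv.ofBijective φ ⟨fun x y h => h3 x y h, fun y => ?_⟩, fun {x y} => h2 x y⟩,
        (mem_fixingSubgroup_iff _).2 fun v hv => h1 v hv, rfl⟩
      obtain ⟨x, -, hx⟩ := h4 y
      exact ⟨x, hx⟩
  rw [himg]
  have hcomp : IsCompact (Set.univ.pi (fun x => {y | X.dist v₀ y ≤ X.dist v₀ x})) :=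
    isCompact_univ_pi fun x => (finite_setOf_dist_le hX v₀ _).isCompact
  refine hcomp.inter_left ?_
  have hcont2 : ∀ (x y : V) (p : V → V → Prop), IsClosed {φ : V → V | p (φ x) (φ y)} := by
    intro x y p
    have hc : Continuous fun φ : V → V => (φ x, φ y) :=
      (continuous_apply x).prodMk (continuous_apply y)
    exact (isClosed_discrete {q : V × V | p q.1 q.2}).preimage hc
  refine IsClosed.inter (IsClosed.inter (IsClosed.inter ?_ ?_) ?_) ?_
  · exact isClosed_biInter fun v _ => (hclopen v v).isClosed
  · exact isClosed_iInter fun x => isClosed_iInter fun y =>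
      hcont2 x y fun a b => X.Adj a b ↔ X.Adj x y
  · exact isClosed_iInter fun x => isClosed_iInter fun y =>
      hcont2 x y fun a b => a = b → x = y
  · exact isClosed_iInter fun y => (finite_setOf_dist_le hX v₀ _).isClosed_biUnion
      fun x _ => (hclopen x y).isClosed

end Topology

/-! ### Representations of a totally disconnected group -/

section Representations

open MeasureTheory

variable {G : Type*} [Group G] [TopologicalSpace G] {W : Type*} [AddCommGroup W] [Module ℂ W]

/-- Every vector is fixed by some compact open subgroup. -/
def IsSmooth (π : Representation ℂ G W) : Prop :=
  ∀ w : W, ∃ K : Subgroup G, IsCompact (K : Set G) ∧ IsOpen (K : Set G) ∧ ∀ k ∈ K, π k w = w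

/-- A smooth representation is admissible if the space of `K`-fixed vectors is finite dimensional
for every compact open subgroup `K`. -/
def IsAdmissible (π : Representation ℂ G W) : Prop :=
  IsSmooth π ∧ ∀ K : Subgroup G, IsCompact (K : Set G) → IsOpen (K : Set G) →
    FiniteDimensional ℂ (Representation.invariants (π.comp K.subtype))

theorem IsSmooth.isOpen_fiber [IsTopologicalGroup G] {π : Representation ℂ G W} (hπ : IsSmooth π)
    (w : W) (s : Set W) : IsOpen {x : G | π x w ∈ s} := by
  obtain ⟨K, -, hKo, hK⟩ := hπ w
  rw [isOpen_iff_mem_nhds]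
  intro x hx
  have hmem : x • (K : Set G) ∈ nhds x :=
    (hKo.smul x).mem_nhds ⟨1, K.one_mem, by simp⟩
  refine Filter.mem_of_superset hmem ?_
  rintro _ ⟨k, hk, rfl⟩
  change π (x * k) w ∈ s
  rw [map_mul, Module.End.mul_apply, hK k hk]
  exact hx

theorem isCompact_doubleCoset [IsTopologicalGroup G] {K : Subgroup G} (hK : IsCompact (K : Set G))
    (a : G) : IsCompact (DoubleCoset.doubleCoset a (K : Set G) K) :=
  (hK.mul isCompact_singleton).mul hK

theorem isOpen_doubleCoset [IsTopologicalGroup G] {K : Subgroup G} (hK : IsOpen (K : Set G))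
    (a : G) : IsOpen (DoubleCoset.doubleCoset a (K : Set G) K) :=
  hK.mul_left

variable [MeasurableSpace G]

/-- The vector `∫_G f(x) π(x) w dx`. The function `x ↦ π(x) w` is locally constant, so for `f`
integrable with compact support the integral is the finite sum over the values `u` of this function
of `∫_{π(x) w = u} f(x) dx` times `u`. -/
noncomputable def integralVector (π : Representation ℂ G W) (μ : Measure G) (f : G → ℂ) (w : W) :
    W :=
  ∑ᶠ u : W, (∫ x in {x | π x w = u}, f x ∂μ) • u

theorem dual_integralVector [IsTopologicalGroup G] [BorelSpace G] {π : Representation ℂ G W}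
    (hπ : IsSmooth π) {μ : Measure G} {f : G → ℂ} (hf : Integrable f μ) (hc : HasCompactSupport f)
    (w : W) (φ : Module.Dual ℂ W) :
    Integrable (fun x => f x * φ (π x w)) μ ∧
      φ (integralVector π μ f w) = ∫ x, f x * φ (π x w) ∂μ := by
  classical
  let _ : TopologicalSpace W := ⊥
  have : DiscreteTopology W := ⟨rfl⟩
  have hcont : Continuous fun x => π x w :=
    continuous_discrete_rng.2 fun u => hπ.isOpen_fiber w {u}
  have hfin : ((fun x => π x w) '' tsupport f).Finite := by
    have h : IsCompact (tsupport f) := hc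
    exact isCompact_iff_finite.1 (h.image hcont)
  set s := hfin.toFinset with hs
  have hms : ∀ u : W, MeasurableSet {x | π x w = u} := fun u =>
    (hπ.isOpen_fiber w {u}).measurableSet
  have hoff : ∀ x, π x w ∉ s → f x = 0 := by
    intro x hx
    by_contra hne
    exact hx ((hfin.mem_toFinset).2 ⟨x, subset_tsupport f hne, rfl⟩)
  have hsum : integralVector π μ f w = ∑ u ∈ s, (∫ x in {x | π x w = u}, f x ∂μ) • u := by
    refine finsum_eq_sum_of_support_subset _ fun u hu => ?_
    by_contra hus
    refine hu ?_
    have : ∫ x in {x | π x w = u}, f x ∂μ = 0 := by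
      refine setIntegral_eq_zero_of_forall_eq_zero fun x hx => hoff x ?_
      have hx' : π x w = u := hx
      rw [hx']
      exact hus
    simp [this]
  have hpt : (fun x => f x * φ (π x w)) =
      fun x => ∑ u ∈ s, {x | π x w = u}.indicator (fun x => f x * φ u) x := by
    funext x
    by_cases hx : π x w ∈ s
    · rw [Finset.sum_eq_single_of_mem (π x w) hx]
      · simp
      · intro u _ hu
        exact Set.indicator_of_notMem (s := {x | π x w = u}) (fun h => hu (Eq.symm h)) _
    · rw [hoff x hx, zero_mul]
      refine (Finset.sum_eq_zero fun u _ => ?_).symm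
      rw [Set.indicator_apply, hoff x hx, zero_mul, ite_self]
  have hint : ∀ u ∈ s, Integrable ({x | π x w = u}.indicator fun x => f x * φ u) μ :=
    fun u _ => (hf.mul_const _).indicator (hms u)
  refine ⟨?_, ?_⟩
  · rw [hpt]
    exact integrable_finsetSum _ hint
  · rw [hpt, integral_finsetSum _ hint, hsum, map_sum]
    refine Finset.sum_congr rfl fun u _ => ?_
    rw [integral_indicator (hms u), integral_mul_const, map_smul, smul_eq_mul]

/-- The operator `π(f) = ∫_G f(x) π(x) dx` for `f` integrable with compact support. -/
noncomputable def integralOperator [IsTopologicalGroup G] [BorelSpace G]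
    (π : Representation ℂ G W) (hπ : IsSmooth π) (μ : Measure G) (f : G → ℂ) (hf : Integrable f μ)
    (hc : HasCompactSupport f) : W →ₗ[ℂ] W where
  toFun w := integralVector π μ f w
  map_add' v w := by
    rw [← sub_eq_zero, ← Module.forall_dual_apply_eq_zero_iff ℂ]
    intro φ
    have h1 := dual_integralVector hπ hf hc v φ
    have h2 := dual_integralVector hπ hf hc w φ
    rw [map_sub, map_add, (dual_integralVector hπ hf hc (v + w) φ).2, h1.2, h2.2,
      ← integral_add h1.1 h2.1]
    simp [mul_add]
  map_smul' c w := by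
    rw [← sub_eq_zero, ← Module.forall_dual_apply_eq_zero_iff ℂ]
    intro φ
    rw [map_sub, (dual_integralVector hπ hf hc (c • w) φ).2, RingHom.id_apply, map_smul,
      (dual_integralVector hπ hf hc w φ).2, smul_eq_mul, ← integral_const_mul, sub_eq_zero]
    refine integral_congr_ae (Filter.Eventually.of_forall fun x => ?_)
    simp only [map_smul, smul_eq_mul]
    ring

/-- The operator `π(1_{KaK})` for a compact open subgroup `K`. -/
noncomputable def doubleCosetOperator [IsTopologicalGroup G] [BorelSpace G]
    (π : Representation ℂ G W) (hπ : IsSmooth π) (μ : Measure G) [IsFiniteMeasureOnCompacts μ]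
    (K : Subgroup G) (hKc : IsCompact (K : Set G)) (hKo : IsOpen (K : Set G)) (a : G) :
    W →ₗ[ℂ] W :=
  integralOperator π hπ μ ((DoubleCoset.doubleCoset a (K : Set G) K).indicator fun _ => (1 : ℂ))
    ((integrable_indicator_iff (isOpen_doubleCoset hKo a).measurableSet).2
      (integrableOn_const (isCompact_doubleCoset hKc a).measure_lt_top.ne))
    (HasCompactSupport.intro (isCompact_doubleCoset hKc a) fun _ hx =>
      Set.indicator_of_notMem hx _)

/-- The normalized operator `vol(KaK)⁻¹ π(1_{KaK})`. -/
noncomputable def normalizedDoubleCosetOperator [IsTopologicalGroup G] [BorelSpace G]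
    (π : Representation ℂ G W) (hπ : IsSmooth π) (μ : Measure G) [IsFiniteMeasureOnCompacts μ]
    (K : Subgroup G) (hKc : IsCompact (K : Set G)) (hKo : IsOpen (K : Set G)) (a : G) :
    W →ₗ[ℂ] W :=
  (μ.real (DoubleCoset.doubleCoset a (K : Set G) K) : ℂ)⁻¹ •
    doubleCosetOperator π hπ μ K hKc hKo a

/-- The trace of a linear operator of finite rank: the trace of its restriction to its range. -/
noncomputable def finiteRankTrace (T : W →ₗ[ℂ] W) : ℂ :=
  LinearMap.trace ℂ (LinearMap.range T) (T.rangeRestrict ∘ₗ (LinearMap.range T).subtype)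

end Representations

section Coinvariants

variable {V : Type*} {X : SimpleGraph V} {W : Type*} [AddCommGroup W] [Module ℂ W]

/-- The space `π_S = π / π[S]`, where `π[S]` is spanned by the vectors `π(s) w - w`. -/
abbrev CoinvariantSpace (π : Representation ℂ (X ≃g X) W) (b : Boundary X) : Type _ :=
  Representation.Coinvariants
    ((π.comp (parabolic b).subtype).comp ((horosphericalSubgroup b).subgroupOf (parabolic b)).subtype)

/-- The representation of `P` on the coinvariants `π_S`. -/
noncomputable def coinvariantRep (π : Representation ℂ (X ≃g X) W) (b : Boundary X) :
    Representation ℂ (parabolic b) (CoinvariantSpace π b) :=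
  Representation.toCoinvariants (π.comp (parabolic b).subtype)
    ((horosphericalSubgroup b).subgroupOf (parabolic b))

end Coinvariants

section Tree

variable {V : Type*} {X : SimpleGraph V} {W : Type*} [AddCommGroup W] [Module ℂ W]

/-- The operator `vol(K_j a K_j)⁻¹ π(1_{K_j a K_j})`. -/
noncomputable def heckeOperator [X.LocallyFinite] (hX : X.IsTree) (l : Line X)
    (μ : MeasureTheory.Measure (X ≃g X)) [MeasureTheory.IsFiniteMeasureOnCompacts μ]
    (π : Representation ℂ (X ≃g X) W) (hπ : IsSmooth π) (j : ℕ) (a : X ≃g X) : W →ₗ[ℂ] W :=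
  normalizedDoubleCosetOperator π hπ μ (congruenceSubgroup l j)
    (isCompact_congruenceSubgroup hX.1 l j) (isOpen_congruenceSubgroup hX.1 l j) a

end Tree

end TreeHecke

/-! Write `a` for a power of the generator, `K` for `K_j` and `T` for the normalized operator of `K
a K`. Let `B` and `C` be the elements of `K` supported behind `v_0` and in front of `v_{-1}`
respectively. Since `j ≥ 1`, `K` fixes the edge `v_{-1} v_0`, and an automorphism of a tree that
fixes an edge can be cut into its actions on the two half-trees. So `K = B C`
(`exists_mul_eq_of_mem_congruenceSubgroup`). As `a` moves the line away from `∞`, `a B a⁻¹ ⊆ B` and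
`a⁻¹ C a ⊆ K`.

For `w ∈ π^K` the vector `π(a) w` is therefore fixed by `C`, so its `K`-translates, and their
average `T w`, agree with it modulo `π[B]`. Since `B ⊆ S`, the projection `p : π^K → π_S`
intertwines `T` with `a`. Two further facts give the theorem.

The operator `T` is locally nilpotent on `π^K ∩ π[S]`. A horospherical element agrees on any finite
set with one supported behind some `v_n`, so `π[S]` is the union of the spaces `π[U_n]`, with `U_n`
the group supported behind `v_n`. A power `a^N` conjugates `U_n` into `B`, so `T^N w` lies in
`π[B]`; it is also `K`-fixed, and `π^K ∩ π[K] = 0` because `K` is compact.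

Every class in `π_S` is moved into `p(π^K)` by a power of `a`: for large `N` the vector `π(a^N) w`
is fixed by `C`, and averaging it over `K` does not change its class. As `a` is invertible on `π_S`
and preserves the finite-dimensional space `p(π^K)`, that space is all of `π_S`. Hence the range of
`T` maps onto `π_S` with `T` nilpotent on the kernel, and the traces agree
(`finiteRankTrace_eq_trace`). -/

namespace TreeHecke

/-! ### Half-trees and cutting an automorphism along a fixed edge -/

section HalfTrees

variable {V : Type*} {X : SimpleGraph V}

/-- The vertices closer to `a` than to `b`; for an edge `ab` of a tree this is the half-tree
at `a` obtained by removing the edge. -/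
def halfTree (X : SimpleGraph V) (a b : V) : Set V := {x | X.dist x a < X.dist x b}

theorem mem_halfTree {a b x : V} : x ∈ halfTree X a b ↔ X.dist x a < X.dist x b := Iff.rfl

theorem mem_halfTree_or (hX : X.IsTree) {a b : V} (hab : X.Adj a b) (x : V) :
    x ∈ halfTree X a b ∨ x ∈ halfTree X b a :=
  lt_or_gt_of_ne (hX.dist_ne_of_adj x hab)

theorem notMem_halfTree_of_mem {a b x : V} (h : x ∈ halfTree X a b) : x ∉ halfTree X b a :=
  fun h' => lt_asymm (mem_halfTree.1 h) (mem_halfTree.1 h')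

theorem left_mem_halfTree (hX : X.IsTree) {a b : V} (hab : X.Adj a b) : a ∈ halfTree X a b := by
  rw [mem_halfTree, X.dist_self]
  exact hX.1.pos_dist_of_ne hab.ne

theorem smul_mem_halfTree (hX : X.IsTree) (g : X ≃g X) {a b x : V} :
    g • x ∈ halfTree X (g • a) (g • b) ↔ x ∈ halfTree X a b := by
  simp only [mem_halfTree, dist_smul_smul g hX.1]

/-- In a tree a vertex `x ≠ z` has only one neighbour closer to `z`. -/
theorem eq_of_adj_of_dist_add_one (hX : X.IsTree) {x y y' z : V} (hy : X.Adj x y)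
    (hy' : X.Adj x y') (h : X.dist z x = X.dist z y + 1) (h' : X.dist z x = X.dist z y' + 1) :
    y = y' := by
  obtain ⟨p, hp⟩ := hX.1.exists_walk_length_eq_dist y z
  obtain ⟨p', hp'⟩ := hX.1.exists_walk_length_eq_dist y' z
  rw [X.dist_comm] at hp hp'
  have h1 : (SimpleGraph.Walk.cons hy p).IsPath :=
    SimpleGraph.Walk.isPath_of_length_eq_dist _ (by
      rw [SimpleGraph.Walk.length_cons, X.dist_comm]; omega)
  have h2 : (SimpleGraph.Walk.cons hy' p').IsPath :=
    SimpleGraph.Walk.isPath_of_length_eq_dist _ (by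
      rw [SimpleGraph.Walk.length_cons, X.dist_comm]; omega)
  have h3 := congrArg Subtype.val
    ((hX.isAcyclic.subsingleton_path x z).elim ⟨_, h1⟩ ⟨_, h2⟩)
  simp only [SimpleGraph.Walk.cons.injEq] at h3
  exact h3.1

/-- The only edge between the two half-trees of `ab` is `ab`. -/
theorem eq_of_adj_of_mem_halfTree (hX : X.IsTree) {a b x y : V} (hab : X.Adj a b)
    (hx : x ∈ halfTree X a b) (hy : y ∈ halfTree X b a) (hxy : X.Adj x y) : x = a ∧ y = b := by
  rw [mem_halfTree] at hx hy
  have h1 := hX.dist_eq_dist_add_one_of_adj x hab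
  have h2 := hX.dist_eq_dist_add_one_of_adj y hab
  have h3 := hX.dist_eq_dist_add_one_of_adj a hxy
  have h4 := hX.dist_eq_dist_add_one_of_adj b hxy
  have c1 := X.dist_comm (u := a) (v := x)
  have c2 := X.dist_comm (u := a) (v := y)
  have c3 := X.dist_comm (u := b) (v := x)
  have c4 := X.dist_comm (u := b) (v := y)
  suffices h0 : X.dist x a = 0 by
    exact ⟨hX.1.dist_eq_zero_iff.1 h0, hX.1.dist_eq_zero_iff.1 (by omega)⟩
  -- The distances force `y` to be nearer to `b` than `x` is, but farther from `a`. A neighbour `z`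
  -- of `x` on the way to `a` is nearer to `b` too, so `z = y`, which is absurd.
  by_contra h0
  obtain ⟨p, hp⟩ := hX.1.exists_walk_length_eq_dist x a
  cases p with
  | nil => exact h0 X.dist_self
  | cons hadj p =>
    rename_i z
    rw [SimpleGraph.Walk.length_cons] at hp
    have hza := X.dist_le p
    have hzb := hX.1.dist_triangle (u := z) (v := a) (w := b)
    rw [SimpleGraph.dist_eq_one_iff_adj.2 hab] at hzb
    have hbz := hX.dist_eq_dist_add_one_of_adj b hadj
    have c5 := X.dist_comm (u := b) (v := z)
    have : z = y := eq_of_adj_of_dist_add_one hX (z := b) hadj hxy (by omega) (by omega)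
    subst this
    omega

/-- An automorphism fixing an edge of a tree may be replaced by the identity on one of the two
half-trees. -/
theorem exists_aut_eq_on_halfTree (hX : X.IsTree) {a b : V} (hab : X.Adj a b) (g : X ≃g X)
    (ha : g • a = a) (hb : g • b = b) :
    ∃ u : X ≃g X, (∀ x ∈ halfTree X a b, u • x = g • x) ∧ ∀ x ∈ halfTree X b a, u • x = x := by
  classical
  have key : ∀ g : X ≃g X, g • a = a → g • b = b → ∀ x ∈ halfTree X a b,
      g • x ∈ halfTree X a b := by
    intro g ha hb x hx
    have := (smul_mem_halfTree hX g).2 hx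
    rwa [ha, hb] at this
  have ha' : g⁻¹ • a = a := by rw [inv_smul_eq_iff, ha]
  have hb' : g⁻¹ • b = b := by rw [inv_smul_eq_iff, hb]
  let e : V ≃ V :=
    { toFun := fun x => if x ∈ halfTree X a b then g • x else x
      invFun := fun x => if x ∈ halfTree X a b then g⁻¹ • x else x
      left_inv := fun x => by
        by_cases hx : x ∈ halfTree X a b
        · dsimp only
          rw [if_pos hx, if_pos (key g ha hb x hx), inv_smul_smul]
        · simp [hx]
      right_inv := fun x => by
        by_cases hx : x ∈ halfTree X a b
        · dsimp only
          rw [if_pos hx, if_pos (key g⁻¹ ha' hb' x hx), smul_inv_smul]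
        · simp [hx] }
  have he : ∀ x ∈ halfTree X a b, e x = g • x := fun x hx => if_pos hx
  have he' : ∀ x ∈ halfTree X b a, e x = x := fun x hx => if_neg (notMem_halfTree_of_mem hx)
  have mixed : ∀ x ∈ halfTree X a b, ∀ y ∈ halfTree X b a, X.Adj (e x) (e y) ↔ X.Adj x y := by
    intro x hx y hy
    rw [he x hx, he' y hy]
    constructor
    · intro h
      obtain ⟨h1, rfl⟩ := eq_of_adj_of_mem_halfTree hX hab (key g ha hb x hx) hy h
      rw [← ha] at h1
      rw [smul_left_cancel g h1]
      exact hab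
    · intro h
      obtain ⟨rfl, rfl⟩ := eq_of_adj_of_mem_halfTree hX hab hx hy h
      rwa [ha]
  refine ⟨⟨e, fun {x y} => ?_⟩, he, he'⟩
  rcases mem_halfTree_or hX hab x with hx | hx <;> rcases mem_halfTree_or hX hab y with hy | hy
  · rw [he x hx, he y hy]
    exact g.map_rel_iff
  · exact mixed x hx y hy
  · rw [X.adj_comm, mixed y hy x hx, X.adj_comm]
  · rw [he' x hx, he' y hy]

end HalfTrees

/-! ### Half-trees along a line, and horospherical elements -/

section Lines

variable {V : Type*} {X : SimpleGraph V}

/-- The half-tree at `v_n` containing `v_n, v_{n+1}, …` but not `v_{n-1}`. -/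
def Line.front (l : Line X) (n : ℤ) : Set V := halfTree X (l.vertex n) (l.vertex (n - 1))

/-- The half-tree at `v_{n-1}` containing `v_{n-1}, v_{n-2}, …` but not `v_n`. -/
def Line.back (l : Line X) (n : ℤ) : Set V := halfTree X (l.vertex (n - 1)) (l.vertex n)

variable (l : Line X)

theorem Line.adj_pred (n : ℤ) : X.Adj (l.vertex (n - 1)) (l.vertex n) := by
  simpa using l.adj (n - 1)

theorem Line.mem_front_or_mem_back (hX : X.IsTree) (n : ℤ) (x : V) :
    x ∈ l.front n ∨ x ∈ l.back n :=
  mem_halfTree_or hX (l.adj_pred n).symm x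

/-- Otherwise some `v_n` would have two neighbours `v_{n-1}`, `v_{n+1}` nearer to `x`; in a tree
they coincide, which is backtracking. -/
theorem Line.back_subset_back (hX : X.IsTree) {m n : ℤ} (h : m ≤ n) : l.back m ⊆ l.back n := by
  intro x hx
  induction n, h using Int.leInduction with
  | base => exact hx
  | succ n _ ih =>
    refine (l.mem_front_or_mem_back hX (n + 1) x).resolve_left fun h' => ?_
    rw [Line.front, mem_halfTree, add_sub_cancel_right] at h'
    rw [Line.back, mem_halfTree] at ih
    have h1 := hX.dist_eq_dist_add_one_of_adj x (l.adj_pred n)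
    have h2 := hX.dist_eq_dist_add_one_of_adj x (l.adj n)
    have := eq_of_adj_of_dist_add_one hX (z := x) (l.adj_pred n).symm (l.adj n)
      (by omega) (by omega)
    refine l.no_backtrack (n - 1) (this.trans ?_)
    congr 1
    ring

theorem Line.front_subset_front (hX : X.IsTree) {m n : ℤ} (h : m ≤ n) :
    l.front n ⊆ l.front m := fun x hx =>
  (l.mem_front_or_mem_back hX m x).resolve_right fun h' =>
    notMem_halfTree_of_mem hx (l.back_subset_back hX h h')

theorem Line.dist_le_dist_of_mem_back (hX : X.IsTree) {m n : ℤ} (h : m ≤ n) {x : V}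
    (hx : x ∈ l.back m) : X.dist x (l.vertex m) ≤ X.dist x (l.vertex n) := by
  induction n, h using Int.leInduction with
  | base => exact le_rfl
  | succ n hn ih =>
    have := l.back_subset_back hX (show m ≤ n + 1 by omega) hx
    rw [Line.back, mem_halfTree, add_sub_cancel_right] at this
    omega

theorem Line.dist_le_dist_of_mem_front (hX : X.IsTree) {m n : ℤ} (h : m ≤ n) {x : V}
    (hx : x ∈ l.front n) : X.dist x (l.vertex n) ≤ X.dist x (l.vertex m) := by
  induction m, h using Int.leInductionDown with
  | base => exact le_rfl
  | pred m hm ih =>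
    have : x ∈ l.front m := l.front_subset_front hX hm hx
    rw [Line.front, mem_halfTree] at this
    omega

/-- A vertex in front of every `v_n` would have distances to `v_0, v_1, …` that decrease forever. -/
theorem Line.exists_mem_back (hX : X.IsTree) (x : V) : ∃ N : ℤ, ∀ n, N ≤ n → x ∈ l.back n := by
  suffices h : ∃ N : ℤ, x ∈ l.back N by
    obtain ⟨N, hN⟩ := h
    exact ⟨N, fun n hn => l.back_subset_back hX hn hN⟩
  by_contra! hc
  have key : ∀ n : ℕ, X.dist x (l.vertex n) + n ≤ X.dist x (l.vertex 0) := by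
    intro n
    induction n with
    | zero => simp
    | succ n ih =>
      have := (l.mem_front_or_mem_back hX ((n + 1 : ℕ) : ℤ) x).resolve_right (hc _)
      rw [Line.front, mem_halfTree, Nat.cast_succ, add_sub_cancel_right] at this
      push_cast
      omega
  have := key (X.dist x (l.vertex 0) + 1)
  omega

theorem Line.exists_mem_front (hX : X.IsTree) (x : V) : ∃ N : ℤ, ∀ n, n ≤ N → x ∈ l.front n := by
  suffices h : ∃ N : ℤ, x ∈ l.front N by
    obtain ⟨N, hN⟩ := h
    exact ⟨N, fun n hn => l.front_subset_front hX hn hN⟩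
  by_contra! hc
  have key : ∀ n : ℕ, X.dist x (l.vertex (-n)) + n ≤ X.dist x (l.vertex 0) := by
    intro n
    induction n with
    | zero => simp
    | succ n ih =>
      have := (l.mem_front_or_mem_back hX (-n : ℤ) x).resolve_left (hc _)
      rw [Line.back, mem_halfTree] at this
      rw [Nat.cast_succ, neg_add']
      omega
  have := key (X.dist x (l.vertex 0) + 1)
  omega

theorem Line.exists_subset_back (hX : X.IsTree) {E : Set V} (hE : E.Finite) :
    ∃ N : ℤ, ∀ n, N ≤ n → E ⊆ l.back n := by
  induction E, hE using Set.Finite.induction_on with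
  | empty => exact ⟨0, fun _ _ => Set.empty_subset _⟩
  | @insert x s _ _ ih =>
    obtain ⟨N, hN⟩ := ih
    obtain ⟨M, hM⟩ := l.exists_mem_back hX x
    exact ⟨max N M, fun n hn => Set.insert_subset (hM n ((le_max_right _ _).trans hn))
      (hN n ((le_max_left _ _).trans hn))⟩

theorem Line.exists_subset_front (hX : X.IsTree) {E : Set V} (hE : E.Finite) :
    ∃ N : ℤ, ∀ n, n ≤ N → E ⊆ l.front n := by
  induction E, hE using Set.Finite.induction_on with
  | empty => exact ⟨0, fun _ _ => Set.empty_subset _⟩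
  | @insert x s _ _ ih =>
    obtain ⟨N, hN⟩ := ih
    obtain ⟨M, hM⟩ := l.exists_mem_front hX x
    exact ⟨min N M, fun n hn => Set.insert_subset (hM n (hn.trans (min_le_right _ _)))
      (hN n (hn.trans (min_le_left _ _)))⟩

theorem Line.vertex_mem_front (hX : X.IsTree) {m n : ℤ} (h : n ≤ m) :
    l.vertex m ∈ l.front n :=
  l.front_subset_front hX h (left_mem_halfTree hX (l.adj_pred m).symm)

theorem Ray.dist_vertex (hX : X.IsTree) (r : Ray X) (i n : ℕ) :
    X.dist (r.vertex i) (r.vertex (i + n)) = n := by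
  induction n using Nat.twoStepInduction with
  | zero => simp
  | one => exact SimpleGraph.dist_eq_one_iff_adj.2 (r.adj i)
  | more n h1 h2 =>
    have h3 := hX.dist_eq_dist_add_one_of_adj (r.vertex i) (r.adj (i + (n + 1)))
    by_contra h4
    refine r.no_backtrack (i + n) (eq_of_adj_of_dist_add_one hX (z := r.vertex i)
      (r.adj (i + n)).symm (r.adj (i + n + 1)) ?_ ?_)
    · rw [h1, ← h2]; rfl
    · simp only [← add_assoc] at h2 h3 h4
      have e : X.dist (r.vertex i) (r.vertex (i + n + 2)) =
        X.dist (r.vertex i) (r.vertex (i + n + 1 + 1)) := rfl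
      omega

theorem Ray.exists_eq_line {l : Line X} {r : Ray X} (h : r.cusp = l.infty) :
    ∃ (c : ℤ) (N : ℕ), ∀ i : ℕ, N ≤ i → r.vertex i = l.vertex (i + c) := by
  obtain ⟨s, N, hs⟩ := Quotient.exact (s := raySetoid X) h
  refine ⟨s, N, fun i hi => ?_⟩
  obtain ⟨k, hk, hk'⟩ := hs i hi
  rw [hk', ← hk]
  rfl

/-- The shift of a ray relative to the line plays the role of a Busemann function: it is constant on
horospheres. -/
theorem Ray.shift_eq {l : Line X} (hX : X.IsTree) {r r' : Ray X} {c c' : ℤ} {N N' M : ℕ}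
    (h : ∀ i : ℕ, N ≤ i → r.vertex i = l.vertex (i + c))
    (h' : ∀ i : ℕ, N' ≤ i → r'.vertex i = l.vertex (i + c'))
    (hM : r.vertex M = r'.vertex M) : c = c' := by
  -- Both rays are followed from their common vertex to the same far vertex of the line, in `i` and
  -- `n` steps. Rays are geodesic, so `i = n`.
  obtain ⟨i, hi⟩ : ∃ i : ℕ, i = N + N' + c.natAbs + c'.natAbs := ⟨_, rfl⟩
  obtain ⟨n, hn⟩ : ∃ n : ℕ, (n : ℤ) = i + c - c' := ⟨(i + c - c').toNat, by omega⟩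
  have h1 := h (M + i) (by omega)
  have h2 := h' (M + n) (by omega)
  have h3 : r.vertex (M + i) = r'.vertex (M + n) := by
    rw [h1, h2]
    congr 1
    push_cast
    omega
  have h4 := r.dist_vertex hX M i
  rw [h3, hM, r'.dist_vertex hX] at h4
  omega

theorem SameHorosphere.exists_eq {l : Line X} (hX : X.IsTree) {x y : V}
    (h : SameHorosphere l.infty x y) : ∃ r r' : Ray X, r.vertex 0 = x ∧ r.cusp = l.infty ∧
      r'.vertex 0 = y ∧ r'.cusp = l.infty ∧ ∃ (c : ℤ) (N : ℕ), ∀ i : ℕ, N ≤ i →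
        r.vertex i = l.vertex (i + c) ∧ r'.vertex i = l.vertex (i + c) := by
  obtain ⟨r, r', h1, h2, h3, h4, M, hM⟩ := h
  obtain ⟨c, N, hc⟩ := Ray.exists_eq_line h2
  obtain ⟨c', N', hc'⟩ := Ray.exists_eq_line h4
  obtain rfl := Ray.shift_eq hX hc hc' hM
  exact ⟨r, r', h1, h2, h3, h4, c, N + N', fun i hi => ⟨hc i (by omega), hc' i (by omega)⟩⟩

/-- The ray `(v_n, v_{n+1}, …)` of a line. -/
def Line.rayFrom (l : Line X) (n : ℕ) : Ray X where
  vertex j := l.vertex ((n + j : ℕ) : ℤ)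
  adj j := by simpa [add_assoc] using l.adj (n + j)
  no_backtrack j := by simpa [add_assoc] using l.no_backtrack (n + j)

theorem Line.cusp_rayFrom (n : ℕ) : (l.rayFrom n).cusp = l.infty :=
  Quotient.sound (s := raySetoid X) ⟨n, 0, fun j _ => ⟨n + j, by push_cast; ring, rfl⟩⟩

theorem Ray.shift_eq_of_vertex_zero (hX : X.IsTree) {r : Ray X} {c : ℤ} {N n : ℕ}
    (h : ∀ i : ℕ, N ≤ i → r.vertex i = l.vertex (i + c)) (h0 : r.vertex 0 = l.vertex n) :
    c = n := by
  refine Ray.shift_eq hX (r' := l.rayFrom n) (N' := 0) (M := 0) h (fun i _ => ?_) ?_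
  · simp [Line.rayFrom, add_comm]
  · simpa [Line.rayFrom] using h0

/-- An element of the horospherical subgroup fixes `v_n` for all large `n`. -/
theorem exists_smul_vertex_eq (hX : X.IsTree) {s : X ≃g X}
    (hs : s ∈ horosphericalSubgroup l.infty) :
    ∃ N : ℕ, ∀ n : ℕ, N ≤ n → s • l.vertex n = l.vertex n := by
  have hP : (s • l.posRay).cusp = l.infty := hs.1
  obtain ⟨c, N, hc⟩ := Ray.exists_eq_line hP
  have hN : s • l.vertex ((N + c.natAbs : ℕ) : ℤ) = l.vertex ((N + c.natAbs : ℕ) + c) :=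
    hc (N + c.natAbs) (by omega)
  set n := N + c.natAbs with hn
  -- So far `s` shifts the end of the line by `c`; since it preserves the horosphere of `v_n`,
  -- comparing `v_n` with `v_{n+c}` gives `c = 0`. The choice of `n` keeps `n + c ≥ 0`.
  have hself : l.vertex n ∈ {y | SameHorosphere l.infty (l.vertex n) y} :=
    ⟨l.rayFrom n, l.rayFrom n, rfl, l.cusp_rayFrom n, rfl, l.cusp_rayFrom n, 0, rfl⟩
  have hmem : s • l.vertex n ∈ {y | SameHorosphere l.infty (l.vertex n) y} := by
    have := Set.smul_mem_smul_set (a := s) hself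
    rwa [hs.2 _ ⟨_, rfl⟩] at this
  obtain ⟨r, r', h1, -, h2, -, d, M, hd⟩ := SameHorosphere.exists_eq hX hmem
  obtain ⟨n', hn'⟩ : ∃ n' : ℕ, (n' : ℤ) = n + c := ⟨(n + c).toNat, by omega⟩
  have e1 := Ray.shift_eq_of_vertex_zero l hX (fun i hi => (hd i hi).1) h1
  have e2 := Ray.shift_eq_of_vertex_zero l hX (fun i hi => (hd i hi).2)
    (h2.trans (hN.trans (congrArg l.vertex hn'.symm)))
  obtain rfl : c = 0 := by omega
  refine ⟨N, fun i hi => ?_⟩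
  have := hc i hi
  rwa [add_zero] at this

/-- The subgroup of all automorphisms supported behind `v_n`. -/
def Line.backSubgroup (l : Line X) (n : ℤ) : Subgroup (X ≃g X) :=
  fixingSubgroup (X ≃g X) (l.front n)

theorem Line.mem_backSubgroup {n : ℤ} {g : X ≃g X} :
    g ∈ l.backSubgroup n ↔ ∀ x ∈ l.front n, g • x = x := mem_fixingSubgroup_iff _

theorem Line.backSubgroup_mono (hX : X.IsTree) {m n : ℤ} (h : m ≤ n) :
    l.backSubgroup m ≤ l.backSubgroup n := fun _ hg =>
  l.mem_backSubgroup.2 fun x hx => l.mem_backSubgroup.1 hg x (l.front_subset_front hX h hx)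

/-- Such an element fixes the end of the line pointwise, so a ray to `∞` and its image eventually
coincide with equal indices. -/
theorem Line.backSubgroup_le (hX : X.IsTree) (n : ℤ) :
    l.backSubgroup n ≤ horosphericalSubgroup l.infty := by
  have hfix : ∀ g ∈ l.backSubgroup n, ∀ m : ℤ, n ≤ m → g • l.vertex m = l.vertex m :=
    fun g hg m hm => l.mem_backSubgroup.1 hg _ (l.vertex_mem_front hX hm)
  have hP : ∀ g ∈ l.backSubgroup n, g ∈ parabolic l.infty := by
    intro g hg
    refine Quotient.sound (s := raySetoid X) ⟨0, n.toNat, fun j hj => ⟨j, by simp, ?_⟩⟩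
    exact hfix g hg j (by omega)
  have key : ∀ g ∈ l.backSubgroup n, ∀ x y : V, SameHorosphere l.infty x y →
      SameHorosphere l.infty x (g • y) := by
    intro g hg x y hxy
    obtain ⟨r, r', h1, h2, h3, h4, c, N, hc⟩ := hxy.exists_eq hX
    refine ⟨r, g • r', h1, h2, ?_, ?_, N + n.natAbs + c.natAbs, ?_⟩
    · rw [Ray.smul_vertex, h3]
    · rw [Ray.cusp_smul, h4]
      exact hP g hg
    · obtain ⟨e1, e2⟩ := hc (N + n.natAbs + c.natAbs) (by omega)
      rw [Ray.smul_vertex, e1, e2, hfix g hg _ (by omega)]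
  intro g hg
  refine ⟨hP g hg, ?_⟩
  rintro H ⟨x, rfl⟩
  ext y
  rw [Set.mem_smul_set_iff_inv_smul_mem]
  refine ⟨fun h => ?_, key _ (inv_mem hg) x y⟩
  have := key g hg x _ h
  rwa [smul_inv_smul] at this

/-- A horospherical element agrees on any finite set of vertices with an element supported behind
some `v_n`. -/
theorem exists_mem_backSubgroup_eqOn (hX : X.IsTree) {s : X ≃g X}
    (hs : s ∈ horosphericalSubgroup l.infty) {E : Set V} (hE : E.Finite) :
    ∃ (n : ℤ), ∃ u ∈ l.backSubgroup n, ∀ x ∈ E, u • x = s • x := by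
  obtain ⟨N, hN⟩ := exists_smul_vertex_eq l hX hs
  obtain ⟨M, hM⟩ := l.exists_subset_back hX hE
  obtain ⟨n, hn⟩ : ∃ n : ℕ, n = N + M.natAbs := ⟨_, rfl⟩
  -- The edge `v_n v_{n+1}` is fixed by `s` and has all of `E` behind it, so `s` may be replaced by
  -- the identity in front of it.
  obtain ⟨u, hu, hu'⟩ := exists_aut_eq_on_halfTree hX (l.adj_pred (n + 1 : ℕ)) s
    (by simpa using hN n (by omega)) (hN (n + 1) (by omega))
  exact ⟨(n + 1 : ℕ), u, l.mem_backSubgroup.2 hu', fun x hx => hu x (hM _ (by omega) hx)⟩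

end Lines

/-! ### Factorization of `K_j` and conjugation by translations -/

section Congruence

variable {V : Type*} {X : SimpleGraph V} (l : Line X)

theorem mem_congruenceSubgroup {j : ℕ} {g : X ≃g X} :
    g ∈ congruenceSubgroup l j ↔ ∀ x, X.dist (l.vertex 0) x ≤ j → g • x = x :=
  mem_fixingSubgroup_iff _

/-- The elements of `K_j` that are supported behind `v_0`. -/
def congruenceBack (l : Line X) (j : ℕ) : Subgroup (X ≃g X) :=
  congruenceSubgroup l j ⊓ l.backSubgroup 0

/-- The elements of `K_j` that are supported in front of `v_{-1}`. -/
def congruenceFront (l : Line X) (j : ℕ) : Subgroup (X ≃g X) :=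
  congruenceSubgroup l j ⊓ fixingSubgroup (X ≃g X) (l.back 0)

/-- The bound `1 ≤ j` makes `g` fix both ends of the edge `v_{-1} v_0`, along which it is cut. -/
theorem exists_mul_eq_of_mem_congruenceSubgroup (hX : X.IsTree) {j : ℕ} (hj : 1 ≤ j)
    {g : X ≃g X} (hg : g ∈ congruenceSubgroup l j) :
    ∃ u ∈ congruenceBack l j, ∃ v ∈ congruenceFront l j, u * v = g := by
  have hg' := (mem_congruenceSubgroup l).1 hg
  have hadj := l.adj_pred 0
  obtain ⟨u, hu, hu'⟩ := exists_aut_eq_on_halfTree hX hadj g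
    (hg' _ (by rw [SimpleGraph.dist_eq_one_iff_adj.2 hadj.symm]; exact hj))
    (hg' _ (by simp))
  have huK : u ∈ congruenceSubgroup l j := by
    refine (mem_congruenceSubgroup l).2 fun x hx => ?_
    rcases mem_halfTree_or hX hadj x with h | h
    · rw [hu x h, hg' x hx]
    · exact hu' x h
  refine ⟨u, ⟨huK, l.mem_backSubgroup.2 hu'⟩, u⁻¹ * g, ⟨Subgroup.mul_mem _ (Subgroup.inv_mem _ huK) hg, ?_⟩,
    mul_inv_cancel_left u g⟩
  refine (mem_fixingSubgroup_iff _).2 fun x hx => ?_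
  rw [mul_smul, inv_smul_eq_iff, hu x hx]

variable {a : X ≃g X} {k : ℕ}

theorem smul_mem_front (hX : X.IsTree) (ha : ∀ i : ℤ, a • l.vertex i = l.vertex (i - k)) {n : ℤ}
    {x : V} : a • x ∈ l.front (n - k) ↔ x ∈ l.front n := by
  have := smul_mem_halfTree hX a (a := l.vertex n) (b := l.vertex (n - 1)) (x := x)
  rwa [ha, ha, sub_right_comm] at this

theorem smul_mem_back (hX : X.IsTree) (ha : ∀ i : ℤ, a • l.vertex i = l.vertex (i - k)) {n : ℤ}
    {x : V} : a • x ∈ l.back (n - k) ↔ x ∈ l.back n := by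
  have := smul_mem_halfTree hX a (a := l.vertex (n - 1)) (b := l.vertex n) (x := x)
  rwa [ha, ha, sub_right_comm] at this

theorem pow_smul_vertex (ha : ∀ i : ℤ, a • l.vertex i = l.vertex (i - k)) (N : ℕ) (i : ℤ) :
    a ^ N • l.vertex i = l.vertex (i - (N * k : ℕ)) := by
  induction N generalizing i with
  | zero => simp
  | succ N ih =>
    rw [pow_succ, mul_smul, ha, ih]
    congr 1
    push_cast
    ring

/-- The conjugate is supported behind `v_{-k}`. A vertex `x` there is no farther from `v_{-k} = a
v_0` than from `v_0`, so if `x` is in the `j`-ball about `v_0`, so is `a⁻¹ x`. -/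
theorem conj_mem_congruenceBack (hX : X.IsTree)
    (ha : ∀ i : ℤ, a • l.vertex i = l.vertex (i - k)) {j : ℕ} {g : X ≃g X}
    (hg : g ∈ congruenceBack l j) : a * g * a⁻¹ ∈ congruenceBack l j := by
  have h1 := (mem_congruenceSubgroup l).1 hg.1
  have h2 := l.mem_backSubgroup.1 hg.2
  have key : ∀ x ∈ l.front (0 - k), (a * g * a⁻¹) • x = x := by
    intro x hx
    rw [mul_smul, mul_smul, h2, smul_inv_smul]
    rwa [← smul_mem_front l hX ha, smul_inv_smul]
  refine ⟨(mem_congruenceSubgroup l).2 fun x hx => ?_, l.mem_backSubgroup.2 fun x hx =>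
    key x (l.front_subset_front hX (by omega) hx)⟩
  rcases l.mem_front_or_mem_back hX (0 - k) x with h | h
  · exact key x h
  · have hd := l.dist_le_dist_of_mem_back hX (n := 0) (by omega) h
    rw [mul_smul, mul_smul, h1, smul_inv_smul]
    rw [← dist_smul_smul a hX.1, smul_inv_smul, ha, X.dist_comm]
    rw [X.dist_comm] at hx
    omega

/-- For `x` in the `j`-ball, either `x` is in front of `v_{k-1}`, where `a x` stays in the ball, or
`a x` lies behind `v_0`, where `g` is trivial. -/
theorem conj_inv_mem_congruenceSubgroup (hX : X.IsTree)
    (ha : ∀ i : ℤ, a • l.vertex i = l.vertex (i - k)) {j : ℕ} {g : X ≃g X}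
    (hg : g ∈ congruenceFront l j) : a⁻¹ * g * a ∈ congruenceSubgroup l j := by
  have h1 := (mem_congruenceSubgroup l).1 hg.1
  have h2 := (mem_fixingSubgroup_iff _).1 hg.2
  refine (mem_congruenceSubgroup l).2 fun x hx => ?_
  rw [mul_smul, mul_smul, inv_smul_eq_iff]
  rcases l.mem_front_or_mem_back hX k x with h | h
  · have hd := l.dist_le_dist_of_mem_front hX (m := 0) (by omega) h
    refine h1 _ ?_
    have h3 := dist_smul_smul a hX.1 (l.vertex k) x
    rw [ha, sub_self] at h3
    rw [h3, X.dist_comm]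
    rw [X.dist_comm] at hx
    omega
  · refine h2 _ ?_
    have := (smul_mem_back l hX ha).2 h
    rwa [sub_self] at this

theorem exists_conj_pow_mem_congruenceBack [X.LocallyFinite] (hX : X.IsTree) (hk : 0 < k)
    (ha : ∀ i : ℤ, a • l.vertex i = l.vertex (i - k)) (j : ℕ) (n : ℤ) :
    ∃ N : ℕ, ∀ g ∈ l.backSubgroup n, a ^ N * g * (a ^ N)⁻¹ ∈ congruenceBack l j := by
  obtain ⟨M, hM⟩ := l.exists_subset_front hX (finite_setOf_dist_le hX.1 (l.vertex 0) j)
  -- The exponent ensures `n - N k ≤ min M 0`: the conjugate is supported behind the whole `j`-ball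
  -- and behind `v_0`.
  refine ⟨n.natAbs + M.natAbs, fun g hg => ?_⟩
  have hN := pow_smul_vertex l ha (n.natAbs + M.natAbs)
  have hle : n.natAbs + M.natAbs ≤ (n.natAbs + M.natAbs) * k := Nat.le_mul_of_pos_right _ hk
  set N := n.natAbs + M.natAbs
  have key : ∀ x ∈ l.front (n - (N * k : ℕ)), (a ^ N * g * (a ^ N)⁻¹) • x = x := by
    intro x hx
    rw [mul_smul, mul_smul, l.mem_backSubgroup.1 hg, smul_inv_smul]
    rwa [← smul_mem_front l hX hN, smul_inv_smul]
  refine ⟨(mem_congruenceSubgroup l).2 fun x hx => key x (hM _ (by omega) hx),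
    l.mem_backSubgroup.2 fun x hx => key x (l.front_subset_front hX (by omega) hx)⟩

/-- Conjugating by `a⁻ᴺ` pushes the support of the front part towards `∞`, past any finite set. -/
theorem exists_conj_pow_smul_eq (hX : X.IsTree) (hk : 0 < k)
    (ha : ∀ i : ℤ, a • l.vertex i = l.vertex (i - k)) (j : ℕ) {E : Set V} (hE : E.Finite) :
    ∃ N : ℕ, ∀ g ∈ congruenceFront l j, ∀ x ∈ E, ((a ^ N)⁻¹ * g * a ^ N) • x = x := by
  obtain ⟨M, hM⟩ := l.exists_subset_back hX hE
  refine ⟨M.natAbs, fun g hg x hx => ?_⟩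
  have hN := pow_smul_vertex l ha M.natAbs
  have hle : M.natAbs ≤ M.natAbs * k := Nat.le_mul_of_pos_right _ hk
  rw [mul_smul, mul_smul, inv_smul_eq_iff]
  refine (mem_fixingSubgroup_iff _).1 hg.2 _ ?_
  have := (smul_mem_back l hX hN).2 (hM (M.natAbs * k : ℕ) (by omega) hx)
  rwa [sub_self] at this

end Congruence

/-! ### Comparison of traces -/

section LinearAlgebra

open Module

variable {F E Y : Type*} [Field F] [AddCommGroup E] [Module F E] [AddCommGroup Y] [Module F Y]

/-- An endomorphism that is nilpotent on the kernel of an equivariant surjection has the same trace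
as the induced endomorphism of the image. -/
theorem trace_eq_of_surjective_of_nilpotent [FiniteDimensional F E] {T : End F E} {B : End F Y}
    {f : E →ₗ[F] Y} (hf : Function.Surjective f) (hTB : ∀ x, f (T x) = B (f x))
    (hnil : ∀ x, f x = 0 → ∃ N : ℕ, (T ^ N) x = 0) : LinearMap.trace F E T = LinearMap.trace F Y B := by
  have : FiniteDimensional F Y := Module.Finite.of_surjective f hf
  obtain ⟨s, hs⟩ := f.exists_rightInverse_of_surjective (LinearMap.range_eq_top.2 hf)
  have hs' : ∀ y, f (s y) = y := fun y => LinearMap.congr_fun hs y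
  let r : E →ₗ[F] LinearMap.ker f := (LinearMap.id - s ∘ₗ f).codRestrict (LinearMap.ker f)
    fun x => by simp [hs']
  let ι := (LinearMap.ker f).subtype
  have hr : ∀ x, ι (r x) = x - s (f x) := fun x => rfl
  have hker : ∀ x : LinearMap.ker f, f x = 0 := fun x => x.2
  -- By cyclicity the two summands have the traces of `f T s = B` and of `r T ι`, the restriction of
  -- `T` to the kernel, which is nilpotent.
  have hdec : T = (T ∘ₗ s) ∘ₗ f + (T ∘ₗ ι) ∘ₗ r := by
    ext x
    simp [hr]
  have hB : f ∘ₗ T ∘ₗ s = B := by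
    ext y
    simp [hTB, hs']
  have hι : ∀ x, ι ((r ∘ₗ T ∘ₗ ι) x) = T (ι x) := by
    intro x
    rw [LinearMap.comp_apply, hr]
    have : f (T (ι x)) = 0 := by
      rw [hTB]
      change B (f x) = 0
      rw [hker, map_zero]
    rw [LinearMap.comp_apply, this, map_zero, sub_zero]
  have hpow : ∀ (N : ℕ) x, ι (((r ∘ₗ T ∘ₗ ι) ^ N) x) = (T ^ N) (ι x) := by
    intro N
    induction N with
    | zero => intro x; rfl
    | succ N ih =>
      intro x
      rw [pow_succ, Module.End.mul_apply, ih, hι, pow_succ, Module.End.mul_apply]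
  have hN : IsNilpotent (r ∘ₗ T ∘ₗ ι : End F (LinearMap.ker f)) := by
    rw [Module.End.isNilpotent_iff_of_finite]
    intro x
    obtain ⟨N, hN⟩ := hnil x x.2
    exact ⟨N, Subtype.ext ((hpow N x).trans hN)⟩
  rw [hdec, map_add, LinearMap.trace_comp_comm', LinearMap.trace_comp_comm' r (T ∘ₗ ι), hB,
    (LinearMap.isNilpotent_trace_of_isNilpotent hN).eq_zero, add_zero]

end LinearAlgebra

section Comparison

variable {W Y : Type*} [AddCommGroup W] [Module ℂ W] [AddCommGroup Y] [Module ℂ Y]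

/-- If `T` maps `W` to a finite dimensional subspace `F`, and on `F` lifts an injective operator `B`
on a quotient `p : W → Y`, with `T` locally nilpotent on `F ∩ ker p` and every element of `Y` moved
to `p(F)` by a power of `B`, then `Y` is finite dimensional and `T` and `B` have equal traces. -/
theorem finiteRankTrace_eq_trace {F : Submodule ℂ W} [FiniteDimensional ℂ F] {T : Module.End ℂ W}
    (hT : LinearMap.range T ≤ F) {p : W →ₗ[ℂ] Y} {B : Module.End ℂ Y}
    (hp : Function.Surjective p) (hB : Function.Injective B)
    (hTB : ∀ w ∈ F, p (T w) = B (p w))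
    (hnil : ∀ w ∈ F, p w = 0 → ∃ N : ℕ, (T ^ N) w = 0)
    (hF : ∀ w, ∃ N : ℕ, (B ^ N) (p w) ∈ F.map p) :
    FiniteDimensional ℂ (LinearMap.range T) ∧ FiniteDimensional ℂ Y ∧
      finiteRankTrace T = LinearMap.trace ℂ Y B := by
  have hfin : FiniteDimensional ℂ (LinearMap.range T) := Submodule.finiteDimensional_of_le hT
  have hTF : ∀ w, T w ∈ F := fun w => hT ⟨w, rfl⟩
  set J := F.map p with hJ
  have hJle : J.map B ≤ J := by
    rintro _ ⟨_, ⟨w, hw, rfl⟩, rfl⟩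
    exact ⟨T w, hTF w, hTB w hw⟩
  -- Injectivity of `B` and finite dimension turn stability into equality, so membership in `J` can
  -- be pulled back along powers of `B`.
  have hJeq : J.map B = J := Submodule.eq_of_le_of_finrank_eq hJle
    (LinearEquiv.finrank_eq (Submodule.equivMapOfInjective B hB J)).symm
  have hback : ∀ (N : ℕ) y, (B ^ N) y ∈ J → y ∈ J := by
    intro N
    induction N with
    | zero => exact fun y h => h
    | succ N ih =>
      intro y h
      rw [pow_succ, Module.End.mul_apply] at h
      have h1 := ih _ h
      rw [← hJeq] at h1
      obtain ⟨y', hy', h2⟩ := h1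
      rwa [← hB h2]
  have htop : J = ⊤ := by
    refine eq_top_iff.2 fun y _ => ?_
    obtain ⟨w, rfl⟩ := hp y
    obtain ⟨N, hN⟩ := hF w
    exact hback N _ hN
  have hYfin : FiniteDimensional ℂ Y := by
    have : FiniteDimensional ℂ (⊤ : Submodule ℂ Y) := htop ▸ (inferInstance : FiniteDimensional ℂ J)
    exact Module.Finite.equiv (Submodule.topEquiv : (⊤ : Submodule ℂ Y) ≃ₗ[ℂ] Y)
  refine ⟨hfin, hYfin, ?_⟩
  have hco : ∀ x : LinearMap.range T,
      (((T.rangeRestrict ∘ₗ (LinearMap.range T).subtype) x : LinearMap.range T) : W) = T x :=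
    fun _ => rfl
  refine trace_eq_of_surjective_of_nilpotent (f := p ∘ₗ (LinearMap.range T).subtype) ?_ ?_ ?_
  · intro y
    -- Because `B` maps `p(F)` onto `Y`, vectors `T w` with `w ∈ F` already cover `Y`.
    have hy : y ∈ J.map B := by rw [hJeq, htop]; trivial
    obtain ⟨_, ⟨w, hw, rfl⟩, rfl⟩ := hy
    exact ⟨⟨T w, w, rfl⟩, hTB w hw⟩
  · rintro ⟨x, hx⟩
    exact hTB x (hT hx)
  · rintro ⟨x, hx⟩ h
    obtain ⟨N, hN⟩ := hnil x (hT hx) h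
    refine ⟨N, Subtype.ext ?_⟩
    rw [ZeroMemClass.coe_zero, ← hN]
    generalize hz : (⟨x, hx⟩ : LinearMap.range T) = z
    have : x = z := by rw [← hz]
    rw [this]
    clear hz hN h this
    induction N generalizing z with
    | zero => rfl
    | succ N ih => rw [pow_succ, Module.End.mul_apply, ih, hco, pow_succ, Module.End.mul_apply]

end Comparison

/-! ### Averaging in smooth representations -/

section SmoothRepresentations

open MeasureTheory Representation

variable {G : Type*} [Group G] {W : Type*} [AddCommGroup W] [Module ℂ W] {π : Representation ℂ G W}

/-- The kernel of the projection to the coinvariants of a subgroup. -/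
abbrev coinvariantsKer (π : Representation ℂ G W) (H : Subgroup G) : Submodule ℂ W :=
  Coinvariants.ker (π.comp H.subtype)

theorem sub_mem_coinvariantsKer {H : Subgroup G} {h : G} (hh : h ∈ H) (w : W) :
    π h w - w ∈ coinvariantsKer π H :=
  Coinvariants.sub_mem_ker (ρ := π.comp H.subtype) ⟨h, hh⟩ w

theorem coinvariantsKer_le {H : Subgroup G} {Q : Submodule ℂ W}
    (h : ∀ g ∈ H, ∀ w, π g w - w ∈ Q) : coinvariantsKer π H ≤ Q := by
  refine Submodule.span_le.2 ?_
  rintro _ ⟨⟨g, w⟩, rfl⟩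
  exact h g g.2 w

theorem coinvariantsKer_mono {H H' : Subgroup G} (h : H ≤ H') :
    coinvariantsKer π H ≤ coinvariantsKer π H' :=
  coinvariantsKer_le fun _ hg w => sub_mem_coinvariantsKer (h hg) w

theorem apply_mem_coinvariantsKer {H H' : Subgroup G} {a : G} (h : ∀ g ∈ H, a * g * a⁻¹ ∈ H')
    {w : W} (hw : w ∈ coinvariantsKer π H) : π a w ∈ coinvariantsKer π H' := by
  suffices hle : coinvariantsKer π H ≤ (coinvariantsKer π H').comap (π a) from hle hw
  refine coinvariantsKer_le fun g hg w => ?_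
  have := sub_mem_coinvariantsKer (π := π) (h g hg) (π a w)
  rw [Submodule.mem_comap, map_sub]
  rwa [← Module.End.mul_apply, ← map_mul, inv_mul_cancel_right, map_mul, Module.End.mul_apply] at this

variable [TopologicalSpace G] [IsTopologicalGroup G]

theorem IsSmooth.finite_orbit (hπ : IsSmooth π) {K : Set G} (hK : IsCompact K) (w : W) :
    ((fun g => π g w) '' K).Finite := by
  let _ : TopologicalSpace W := ⊥
  have : DiscreteTopology W := ⟨rfl⟩
  have hcont : Continuous fun x => π x w :=
    continuous_discrete_rng.2 fun u => hπ.isOpen_fiber w {u}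
  exact isCompact_iff_finite.1 (hK.image hcont)

/-- Averaging over a compact subgroup. -/
theorem IsSmooth.exists_invariant_sub_mem (hπ : IsSmooth π) {K : Subgroup G}
    (hK : IsCompact (K : Set G)) {w : W} {Q : Submodule ℂ W} (hQ : ∀ g ∈ K, π g w - w ∈ Q) :
    ∃ w', (∀ g ∈ K, π g w' = w') ∧ w' - w ∈ Q := by
  set s := (hπ.finite_orbit hK w).toFinset with hs
  have hmem : ∀ x, x ∈ s ↔ ∃ g ∈ K, π g w = x := fun x => by simp [hs]
  have hmaps : ∀ g ∈ K, ∀ x ∈ s, π g x ∈ s := by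
    intro g hg x hx
    obtain ⟨h, hh, rfl⟩ := (hmem x).1 hx
    exact (hmem _).2 ⟨g * h, mul_mem hg hh, by rw [map_mul, Module.End.mul_apply]⟩
  have hcard : (s.card : ℂ) ≠ 0 := by
    have : w ∈ s := (hmem w).2 ⟨1, one_mem K, by simp⟩
    exact_mod_cast (Finset.card_pos.2 ⟨w, this⟩).ne'
  -- The orbit of `w` is finite and `K` permutes it, so its unweighted mean is invariant.
  refine ⟨(s.card : ℂ)⁻¹ • ∑ x ∈ s, x, fun g hg => ?_, ?_⟩
  · rw [map_smul, map_sum]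
    congr 1
    refine Finset.sum_nbij' (π g) (π g⁻¹) (hmaps g hg) (hmaps _ (inv_mem hg)) ?_ ?_ ?_
    · intro x _; simp
    · intro x _; simp
    · intro x _; rfl
  · have : (s.card : ℂ)⁻¹ • ∑ x ∈ s, x - w = (s.card : ℂ)⁻¹ • ∑ x ∈ s, (x - w) := by
      rw [Finset.sum_sub_distrib, Finset.sum_const, smul_sub, ← Nat.cast_smul_eq_nsmul ℂ,
        inv_smul_smul₀ hcard]
    rw [this]
    refine Q.smul_mem _ (Q.sum_mem fun x hx => ?_)
    obtain ⟨g, hg, rfl⟩ := (hmem x).1 hx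
    exact hQ g hg

variable [MeasurableSpace G] [BorelSpace G]

/-- For a compact group, invariants and the kernel of the projection to coinvariants meet in `0`. -/
theorem IsSmooth.eq_zero_of_mem_coinvariantsKer (hπ : IsSmooth π) {K : Subgroup G}
    (hK : IsCompact (K : Set G)) {w : W} (hw : ∀ g ∈ K, π g w = w)
    (hw' : w ∈ coinvariantsKer π K) : w = 0 := by
  have : CompactSpace K := isCompact_iff_compactSpace.1 hK
  rw [← Module.forall_dual_apply_eq_zero_iff ℂ]
  intro φ
  have hcont : ∀ w, Continuous fun k : K => φ (π (k : G)⁻¹ w) := by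
    intro w
    let _ : TopologicalSpace W := ⊥
    have : DiscreteTopology W := ⟨rfl⟩
    have h1 : Continuous fun x => π x w :=
      continuous_discrete_rng.2 fun u => hπ.isOpen_fiber w {u}
    have h2 : Continuous φ := continuous_of_discreteTopology
    exact h2.comp (h1.comp continuous_subtype_val.inv)
  have hint : ∀ w, Integrable (fun k : K => φ (π (k : G)⁻¹ w)) (Measure.haar : Measure K) :=
    fun w => (hcont w).integrable_of_hasCompactSupport (HasCompactSupport.of_compactSpace _)
  -- The inverse turns left invariance of Haar measure into `Λ (π g w) = Λ w`; on a `K`-fixed vector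
  -- `Λ` is `φ` times the total mass.
  let Λ : W →ₗ[ℂ] ℂ :=
    { toFun := fun w => ∫ k : K, φ (π (k : G)⁻¹ w) ∂Measure.haar
      map_add' := fun v w => by
        simp only [map_add]
        exact integral_add (hint v) (hint w)
      map_smul' := fun c w => by
        simp only [map_smul, smul_eq_mul, RingHom.id_apply]
        exact integral_const_mul _ _ }
  have hle : coinvariantsKer π K ≤ LinearMap.ker Λ := by
    refine coinvariantsKer_le fun g hg w => ?_
    rw [LinearMap.mem_ker, map_sub, sub_eq_zero]
    have := integral_mul_left_eq_self (μ := (Measure.haar : Measure K))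
      (fun k : K => φ (π (k : G)⁻¹ w)) (⟨g, hg⟩⁻¹ : K)
    refine Eq.trans ?_ this
    refine integral_congr_ae (Filter.Eventually.of_forall fun k => ?_)
    simp [Module.End.mul_apply]
  have h0 : Λ w = 0 := hle hw'
  have h1 : Λ w = ∫ _ : K, φ w ∂Measure.haar :=
    integral_congr_ae (Filter.Eventually.of_forall fun k => by
      change φ (π (k : G)⁻¹ w) = φ w
      rw [hw _ (inv_mem k.2)])
  rw [h1, integral_const, smul_eq_zero] at h0
  refine h0.resolve_left ?_
  have : IsFiniteMeasure (Measure.haar : Measure K) := inferInstance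
  exact (measureReal_ne_zero_iff (measure_ne_top _ _)).2
    (isOpen_univ.measure_ne_zero _ Set.univ_nonempty)

variable {μ : Measure G} [μ.IsHaarMeasure] {K : Subgroup G}

theorem dual_normalizedDoubleCosetOperator (hπ : IsSmooth π) (hKc : IsCompact (K : Set G))
    (hKo : IsOpen (K : Set G)) (a : G) (w : W) (φ : Module.Dual ℂ W) :
    φ (normalizedDoubleCosetOperator π hπ μ K hKc hKo a w) =
      (μ.real (DoubleCoset.doubleCoset a (K : Set G) K) : ℂ)⁻¹ *
        ∫ x, (DoubleCoset.doubleCoset a (K : Set G) K).indicator (fun _ => (1 : ℂ)) x *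
          φ (π x w) ∂μ := by
  rw [normalizedDoubleCosetOperator, LinearMap.smul_apply, map_smul, smul_eq_mul]
  congr 1
  exact (dual_integralVector hπ
    ((integrable_indicator_iff (isOpen_doubleCoset hKo a).measurableSet).2
      (integrableOn_const (isCompact_doubleCoset hKc a).measure_lt_top.ne))
    (HasCompactSupport.intro (isCompact_doubleCoset hKc a) fun _ hx =>
      Set.indicator_of_notMem hx _) w φ).2

/-- Both `μ` and the double coset are invariant under left translation by `K`; equality of vectors
is tested on linear functionals. -/
theorem apply_normalizedDoubleCosetOperator (hπ : IsSmooth π) (hKc : IsCompact (K : Set G))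
    (hKo : IsOpen (K : Set G)) (a : G) (w : W) {g : G} (hg : g ∈ K) :
    π g (normalizedDoubleCosetOperator π hπ μ K hKc hKo a w) =
      normalizedDoubleCosetOperator π hπ μ K hKc hKo a w := by
  rw [← sub_eq_zero, ← Module.forall_dual_apply_eq_zero_iff ℂ]
  intro φ
  rw [map_sub, sub_eq_zero]
  have h := dual_normalizedDoubleCosetOperator (μ := μ) hπ hKc hKo a w (φ ∘ₗ π g)
  rw [LinearMap.comp_apply] at h
  rw [h, dual_normalizedDoubleCosetOperator]
  congr 1
  rw [← integral_mul_left_eq_self (fun x =>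
    (DoubleCoset.doubleCoset a (K : Set G) K).indicator (fun _ => (1 : ℂ)) x * φ (π x w)) g]
  refine integral_congr_ae (Filter.Eventually.of_forall fun x => ?_)
  have hx : g * x ∈ DoubleCoset.doubleCoset a (K : Set G) K ↔
      x ∈ DoubleCoset.doubleCoset a (K : Set G) K := by
    simp only [DoubleCoset.mem_doubleCoset, SetLike.mem_coe]
    constructor
    · rintro ⟨y, hy, z, hz, h⟩
      exact ⟨g⁻¹ * y, mul_mem (inv_mem hg) hy, z, hz, by
        rw [mul_assoc, mul_assoc, ← mul_assoc y, ← h, inv_mul_cancel_left]⟩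
    · rintro ⟨y, hy, z, hz, rfl⟩
      exact ⟨g * y, mul_mem hg hy, z, hz, by simp only [mul_assoc]⟩
  simp only [map_mul, LinearMap.comp_apply, Module.End.mul_apply]
  congr 1
  by_cases h' : x ∈ DoubleCoset.doubleCoset a (K : Set G) K
  · rw [Set.indicator_of_mem h', Set.indicator_of_mem (hx.2 h')]
  · rw [Set.indicator_of_notMem h', Set.indicator_of_notMem (mt hx.1 h')]

/-- On `y a z` with `y, z ∈ K` the vector `π(y a z) w = π(y) π(a) w` is congruent to `π(a) w` modulo
`Q`, so a functional vanishing on `Q` sees a constant integrand. -/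
theorem normalizedDoubleCosetOperator_sub_mem (hπ : IsSmooth π) (hKc : IsCompact (K : Set G))
    (hKo : IsOpen (K : Set G)) (a : G) {w : W} (hw : ∀ g ∈ K, π g w = w) {Q : Submodule ℂ W}
    (hQ : ∀ g ∈ K, π g (π a w) - π a w ∈ Q) :
    normalizedDoubleCosetOperator π hπ μ K hKc hKo a w - π a w ∈ Q := by
  by_contra hne
  obtain ⟨φ, hφ, hφQ⟩ := Submodule.exists_le_ker_of_notMem hne
  refine hφ ?_
  rw [map_sub, dual_normalizedDoubleCosetOperator, sub_eq_zero]
  have hconst : (fun x => (DoubleCoset.doubleCoset a (K : Set G) K).indicator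
      (fun _ => (1 : ℂ)) x * φ (π x w)) =
      (DoubleCoset.doubleCoset a (K : Set G) K).indicator fun _ => φ (π a w) := by
    funext x
    by_cases hx : x ∈ DoubleCoset.doubleCoset a (K : Set G) K
    · rw [Set.indicator_of_mem hx, Set.indicator_of_mem hx, one_mul]
      obtain ⟨y, hy, z, hz, rfl⟩ := DoubleCoset.mem_doubleCoset.1 hx
      rw [map_mul, map_mul, Module.End.mul_apply, Module.End.mul_apply, hw z hz, ← sub_eq_zero,
        ← map_sub]
      exact hφQ (hQ y hy)
    · rw [Set.indicator_of_notMem hx, Set.indicator_of_notMem hx, zero_mul]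
  have hpos : μ.real (DoubleCoset.doubleCoset a (K : Set G) K) ≠ 0 := by
    refine (measureReal_ne_zero_iff (isCompact_doubleCoset hKc a).measure_lt_top.ne).2 ?_
    exact (isOpen_doubleCoset hKo a).measure_ne_zero _ ⟨a, DoubleCoset.mem_doubleCoset_self K K a⟩
  rw [hconst, integral_indicator (isOpen_doubleCoset hKo a).measurableSet, setIntegral_const,
    Complex.real_smul, inv_mul_cancel_left₀ (by exact_mod_cast hpos)]

end SmoothRepresentations

/-! ### Horospherical coinvariants -/

section HorosphericalCoinvariants

variable {V : Type*} {X : SimpleGraph V} {W : Type*} [AddCommGroup W] [Module ℂ W]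
  {π : Representation ℂ (X ≃g X) W}

/-- The projection `π → π_S`. -/
noncomputable def coinvariantMk (π : Representation ℂ (X ≃g X) W) (b : Boundary X) :
    W →ₗ[ℂ] CoinvariantSpace π b :=
  Representation.Coinvariants.mk _

theorem coinvariantMk_surjective (b : Boundary X) :
    Function.Surjective (coinvariantMk π b) :=
  Representation.Coinvariants.mk_surjective _

theorem coinvariantMk_apply (b : Boundary X) (p : parabolic b) (w : W) :
    coinvariantRep π b p (coinvariantMk π b w) = coinvariantMk π b (π p w) := rfl

theorem coinvariantMk_eq_zero {b : Boundary X} {w : W} :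
    coinvariantMk π b w = 0 ↔ w ∈ coinvariantsKer π (horosphericalSubgroup b) := by
  rw [coinvariantMk, Representation.Coinvariants.mk_eq_zero]
  constructor
  · intro h
    refine (show Representation.Coinvariants.ker _ ≤ _ from Submodule.span_le.2 ?_) h
    rintro _ ⟨⟨g, w⟩, rfl⟩
    exact sub_mem_coinvariantsKer (Subgroup.mem_subgroupOf.1 g.2) w
  · intro h
    refine (show coinvariantsKer π _ ≤ _ from coinvariantsKer_le fun g hg w => ?_) h
    exact Representation.Coinvariants.sub_mem_ker
      (ρ := (π.comp (parabolic b).subtype).comp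
        ((horosphericalSubgroup b).subgroupOf (parabolic b)).subtype)
      ⟨⟨g, hg.1⟩, Subgroup.mem_subgroupOf.2 hg⟩ w

/-- A vector of a smooth representation is fixed by the pointwise stabilizer of a finite set of
vertices. -/
theorem IsSmooth.exists_finite_fixing (hπ : IsSmooth π) (w : W) :
    ∃ E : Set V, E.Finite ∧ ∀ g : X ≃g X, (∀ x ∈ E, g • x = x) → π g w = w := by
  let _ : TopologicalSpace V := ⊥
  have : DiscreteTopology V := ⟨rfl⟩
  have hopen : IsOpen {g : X ≃g X | π g w = w} := hπ.isOpen_fiber w {w}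
  obtain ⟨O, hO, hpre⟩ := isOpen_induced_iff.1 hopen
  have h1 : (fun x : V => x) ∈ O := by
    have : (1 : X ≃g X) ∈ {g : X ≃g X | π g w = w} := by simp
    rw [← hpre] at this
    exact this
  obtain ⟨I, u, hu, hsub⟩ := isOpen_pi_iff.1 hO _ h1
  refine ⟨I, I.finite_toSet, fun g hg => ?_⟩
  have : g ∈ {g : X ≃g X | π g w = w} := by
    rw [← hpre]
    refine hsub fun x hx => ?_
    have hgx : g x = x := hg x hx
    change g x ∈ u x
    rw [hgx]
    exact (hu x hx).2
  exact this

/-- The kernel of `π → π_S` is the union of the kernels for the subgroups of elements supported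
behind `v_n`. -/
theorem exists_mem_coinvariantsKer_backSubgroup (hX : X.IsTree) (hπ : IsSmooth π) (l : Line X)
    {w : W} (hw : w ∈ coinvariantsKer π (horosphericalSubgroup l.infty)) :
    ∃ n, w ∈ coinvariantsKer π (l.backSubgroup n) := by
  have hdir : Directed (· ≤ ·) fun n => coinvariantsKer π (l.backSubgroup n) := fun m n =>
    ⟨max m n, coinvariantsKer_mono (l.backSubgroup_mono hX (le_max_left _ _)),
      coinvariantsKer_mono (l.backSubgroup_mono hX (le_max_right _ _))⟩
  rw [← Submodule.mem_iSup_of_directed _ hdir]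
  refine coinvariantsKer_le (fun s hs w => ?_) hw
  obtain ⟨E, hE, hfix⟩ := hπ.exists_finite_fixing w
  obtain ⟨n, u, hu, hus⟩ := exists_mem_backSubgroup_eqOn l hX hs hE
  -- By smoothness only the action of `s` on the finite set `E` matters for `w`.
  have h : π s w = π u w := by
    have := hfix (u⁻¹ * s) fun x hx => by rw [mul_smul, inv_smul_eq_iff, hus x hx]
    rw [map_mul, Module.End.mul_apply] at this
    conv_rhs => rw [← this, ← Module.End.mul_apply, ← map_mul, mul_inv_cancel, map_one,
      Module.End.one_apply]
  rw [h]
  exact Submodule.mem_iSup_of_mem n (sub_mem_coinvariantsKer hu w)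

end HorosphericalCoinvariants

/-! ### The trace identity -/

section Main

variable {V : Type*} {X : SimpleGraph V} [X.LocallyFinite] {W : Type*} [AddCommGroup W]
  [Module ℂ W] {π : Representation ℂ (X ≃g X) W} {l : Line X} {a : X ≃g X} {k : ℕ}

theorem finiteRankTrace_heckeOperator (hX : X.IsTree) (hk : 0 < k)
    (ha : ∀ i : ℤ, a • l.vertex i = l.vertex (i - k)) (haP : a ∈ parabolic l.infty)
    (μ : MeasureTheory.Measure (X ≃g X)) [μ.IsHaarMeasure] (hπ : IsAdmissible π) {j : ℕ}
    (hj : 1 ≤ j) :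
    FiniteDimensional ℂ (LinearMap.range (heckeOperator hX l μ π hπ.1 j a)) ∧
      FiniteDimensional ℂ (CoinvariantSpace π l.infty) ∧
      finiteRankTrace (heckeOperator hX l μ π hπ.1 j a) =
        LinearMap.trace ℂ (CoinvariantSpace π l.infty) (coinvariantRep π l.infty ⟨a, haP⟩) := by
  have hKc := isCompact_congruenceSubgroup hX.1 l j
  have hKo := isOpen_congruenceSubgroup hX.1 l j
  set K := congruenceSubgroup l j with hK
  set T := heckeOperator hX l μ π hπ.1 j a with hT
  let F : Submodule ℂ W := Representation.invariants (π.comp K.subtype)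
  have hFfin : FiniteDimensional ℂ F := hπ.2 K hKc hKo
  have hF : ∀ w, w ∈ F ↔ ∀ g ∈ K, π g w = w := fun w =>
    ⟨fun h g hg => h ⟨g, hg⟩, fun h g => h g g.2⟩
  have hTF : ∀ w, T w ∈ F := fun w => (hF _).2 fun g hg =>
    apply_normalizedDoubleCosetOperator hπ.1 hKc hKo a w hg
  have hBK : congruenceBack l j ≤ K := inf_le_left
  have hBS : congruenceBack l j ≤ horosphericalSubgroup l.infty :=
    inf_le_right.trans (l.backSubgroup_le hX 0)
  have hfactor : ∀ u : W, (∀ g ∈ congruenceFront l j, π g u = u) →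
      ∀ g ∈ K, π g u - u ∈ coinvariantsKer π (congruenceBack l j) := by
    intro u hu g hg
    obtain ⟨x, hx, y, hy, rfl⟩ := exists_mul_eq_of_mem_congruenceSubgroup l hX hj hg
    rw [map_mul, Module.End.mul_apply, hu y hy]
    exact sub_mem_coinvariantsKer hx u
  have hTsub : ∀ w ∈ F, T w - π a w ∈ coinvariantsKer π (congruenceBack l j) := by
    intro w hw
    refine normalizedDoubleCosetOperator_sub_mem hπ.1 hKc hKo a ((hF w).1 hw)
      (hfactor _ fun g hg => ?_)
    have := (hF w).1 hw _ (conj_inv_mem_congruenceSubgroup l hX ha hg)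
    rw [map_mul, map_mul, Module.End.mul_apply, Module.End.mul_apply] at this
    nth_rewrite 2 [← this]
    rw [← Module.End.mul_apply (π a), ← map_mul, mul_inv_cancel, map_one, Module.End.one_apply]
  -- Errors do not accumulate outside `π[B]`, because `a` conjugates `B` into itself.
  have hTpow : ∀ w ∈ F, ∀ N : ℕ, (T ^ N) w ∈ F ∧
      (T ^ N) w - π (a ^ N) w ∈ coinvariantsKer π (congruenceBack l j) := by
    intro w hw N
    induction N with
    | zero => simpa using hw
    | succ N ih =>
      rw [pow_succ', Module.End.mul_apply, pow_succ', map_mul, Module.End.mul_apply]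
      refine ⟨hTF _, ?_⟩
      rw [← sub_add_sub_cancel _ (π a ((T ^ N) w)), ← map_sub]
      exact add_mem (hTsub _ ih.1) (apply_mem_coinvariantsKer
        (fun g hg => conj_mem_congruenceBack l hX ha hg) ih.2)
  have hBinj : Function.Injective (coinvariantRep π l.infty ⟨a, haP⟩) := by
    intro x y hxy
    have := congrArg (coinvariantRep π l.infty ⟨a, haP⟩⁻¹) hxy
    simpa using this
  refine finiteRankTrace_eq_trace (F := F) (p := coinvariantMk π l.infty) ?_
    (coinvariantMk_surjective _) hBinj ?_ ?_ ?_
  · rintro _ ⟨w, rfl⟩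
    exact hTF w
  · intro w hw
    rw [coinvariantMk_apply, ← sub_eq_zero, ← map_sub, coinvariantMk_eq_zero]
    exact coinvariantsKer_mono hBS (hTsub w hw)
  · intro w hw h0
    obtain ⟨n, hn⟩ := exists_mem_coinvariantsKer_backSubgroup hX hπ.1 l
      (coinvariantMk_eq_zero.1 h0)
    obtain ⟨N, hN⟩ := exists_conj_pow_mem_congruenceBack l hX hk ha j n
    refine ⟨N, ?_⟩
    obtain ⟨h1, h2⟩ := hTpow w hw N
    refine hπ.1.eq_zero_of_mem_coinvariantsKer hKc ((hF _).1 h1) (coinvariantsKer_mono hBK ?_)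
    rw [← sub_add_cancel ((T ^ N) w) (π (a ^ N) w)]
    exact add_mem h2 (apply_mem_coinvariantsKer hN hn)
  · intro w
    obtain ⟨E, hE, hfix⟩ := hπ.1.exists_finite_fixing w
    obtain ⟨N, hN⟩ := exists_conj_pow_smul_eq l hX hk ha j hE
    refine ⟨N, ?_⟩
    have hu : ∀ g ∈ congruenceFront l j, π g (π (a ^ N) w) = π (a ^ N) w := by
      intro g hg
      have := hfix _ (hN g hg)
      rw [map_mul, map_mul, Module.End.mul_apply, Module.End.mul_apply] at this
      nth_rewrite 2 [← this]
      rw [← Module.End.mul_apply (π (a ^ N)), ← map_mul, mul_inv_cancel, map_one,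
        Module.End.one_apply]
    -- The average over `K` of a front-fixed vector differs from it by an element of `π[B] ⊆ π[S]`.
    obtain ⟨w', hw', hsub⟩ := hπ.1.exists_invariant_sub_mem hKc (hfactor _ hu)
    refine ⟨w', (hF w').2 hw', ?_⟩
    rw [← map_pow, coinvariantMk_apply, ← sub_eq_zero, ← map_sub, coinvariantMk_eq_zero]
    exact coinvariantsKer_mono hBS hsub

end Main

end TreeHecke

open TreeHecke in
theorem mainTheorem6 {V : Type*} {X : SimpleGraph V} [X.LocallyFinite] (hX : X.IsTree)
    (q : ℕ) (hq : X.IsRegularOfDegree (q + 1)) (l : Line X)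
    (A : Subgroup (X ≃g X)) (hA : IsSplitTorus l A)
    (a₁ : X ≃g X) (ha₁ : a₁ ∈ negativePart l A) (hgen : Subgroup.zpowers a₁ = A)
    (μ : MeasureTheory.Measure (X ≃g X)) [μ.IsHaarMeasure]
    {W : Type*} [AddCommGroup W] [Module ℂ W]
    (π : Representation ℂ (X ≃g X) W) (hπ : IsAdmissible π)
    (j m : ℕ) (hj : 1 ≤ j) (hm : 1 ≤ m) :
    FiniteDimensional ℂ (LinearMap.range (heckeOperator hX l μ π hπ.1 j (a₁ ^ m))) ∧
      FiniteDimensional ℂ (CoinvariantSpace π l.infty) ∧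
      finiteRankTrace (heckeOperator hX l μ π hπ.1 j (a₁ ^ m)) =
        LinearMap.trace ℂ (CoinvariantSpace π l.infty)
          (coinvariantRep π l.infty (⟨a₁, mem_parabolic_of_mem_negativePart ha₁⟩ ^ m)) := by
  obtain ⟨k, hk, hshift⟩ := ha₁.2
  exact finiteRankTrace_heckeOperator hX (Nat.mul_pos hm hk) (pow_smul_vertex l hshift m)
    (pow_mem (mem_parabolic_of_mem_negativePart ha₁) m) μ hπ hj
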